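/- Conventions. A continuum is a nonempty compact connected metrizable space; it is nondegenerate if it has more than one point. An arc is a space homeomorphic to $[0,1]$, a ray is a space homeomorphic to $[0,\infty)$, and a free interval in a space is an open subset homeomorphic to $(0,1)$. A Cantor set is a nonempty compact totally disconnected metrizable space without isolated points. For a metrizable (not necessarily compact) space $Y$, let $\mathcal M(Y)$ be the system of all nonempty compact sets $M\subseteq Y$ for which there is a continuous map $f\colon Y\to Y$ such that $f(M)=M$ and $M$ has no nonempty proper closed subset $N$ with $f(N)\subseteq N$. For disjoint metrizable spaces $Y,Z$, let $\mathcal M^*(Y;Z)$ be the system of all $M\in\mathcal M(Y\sqcup Z)$ such that $M\cap Y$ and $M\cap Z$ have the same cardinality. For systems of sets, $\mathcal A\sqcup\mathcal B$ denotes the union of $\mathcal A$ and $\mathcal B$ and asserts that they are disjoint. Theorem. Let $X$ be a continuum of the form $X=L\cup J\cup R$, where $J$ is a free interval dense in $X$, and $L,R$ are locally connected continua disjoint from $J$ such that, for some rays $J_L,J_R$ with $J=J_L\cup J_R$, the space $L\cup J_L$ is a compactification of $J_L$ and $R\cup J_R$ is a compactification of $J_R$. (1) If $R$ is a singleton, $L$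 is nondegenerate and $R\subseteq L$, then $$\mathcal M(X)=\bigcup\{\mathcal M(L\cup A)\colon A \text{ is an arc},\ R\subseteq A\subset R\cup J\}.$$ (2) If $R$ is a singleton, $L$ is nondegenerate and $L\cap R=\emptyset$, then $$\mathcal M(X)=\mathcal M(L)\sqcup\mathcal M(J\cup R),$$ and $\mathcal M(J\cup R)$ is the system of all nonempty finite subsets and all Cantor subsets of $J\cup R$. (3) If $L,R$ are nondegenerate and $L\cap R\neq\emptyset$, then $$\mathcal M(X)=\mathcal M(L\cup R)\sqcup\mathcal M(J),$$ and $\mathcal M(J)$ is the system of all nonempty finite subsets and all Cantor subsets of $J$. (4) If $L,R$ are nondegenerate and $L\cap R=\emptyset$, then $$\mathcal M(J)\sqcup\mathcal M(L)\sqcup\mathcal M(R)\ \subseteq\ \mathcal M(X)\ \subseteq\ \mathcal M(J)\sqcup\mathcal M(L)\sqcup\mathcal M(R)\sqcup\mathcal M^*(L;R),$$ and $\mathcal M(J)$ is the system of all nonempty finite subsets and all Cantor subsets of $J$. -/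

import Mathlib

open Set Topology

namespace DenseFreeInterval

/-- `M` is a compact minimal set of the map `f : Y → Y`: it is nonempty and compact, `f(M) = M`, and
`M` has no nonempty proper closed subset that is mapped into itself by `f`, so that `f|_M : M → M`
is a minimal dynamical system. (In a Hausdorff space, a subset of the compact set `M` is closed in
`M` iff it is closed in `Y`.) -/
def IsMinimalSetOf {Y : Type*} [TopologicalSpace Y] (f : Y → Y) (M : Set Y) : Prop :=
  M.Nonempty ∧ IsCompact M ∧ f '' M = M ∧
    ∀ N : Set Y, N ⊆ M → N.Nonempty → IsClosed N → MapsTo f N N → N = M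

/-- `𝓜(Y)`: the system of all compact minimal sets of continuous selfmaps of the space `Y`. -/
def minimalSets (Y : Type*) [TopologicalSpace Y] : Set (Set Y) :=
  {M | ∃ f : Y → Y, Continuous f ∧ IsMinimalSetOf f M}

/-- `𝓜(A)` for a subspace `A` of `X`; its members are regarded as subsets of `X`. The selfmaps in
question are the continuous selfmaps of `A` with its subspace topology. -/
def minimalSetsIn {X : Type*} [TopologicalSpace X] (A : Set X) : Set (Set X) :=
  (fun M : Set A => Subtype.val '' M) '' minimalSets A

/-- `𝓜*(A; B)` for disjoint closed sets `A`, `B` of `X`: the members `M` of `𝓜(A ⊔ B)` such that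
`M ∩ A` and `M ∩ B` have the same cardinality. (For disjoint closed sets, the subspace topology
of `A ∪ B` is the topology of the disjoint union.) -/
def minimalSetsStar {X : Type*} [TopologicalSpace X] (A B : Set X) : Set (Set X) :=
  {M | M ∈ minimalSetsIn (A ∪ B) ∧
    Cardinal.mk (M ∩ A : Set X) = Cardinal.mk (M ∩ B : Set X)}

/-- A Cantor set: nonempty, compact, totally disconnected, without isolated points
(and, in the spaces considered here, metrizable). -/
def IsCantorSet {X : Type*} [TopologicalSpace X] (M : Set X) : Prop :=
  M.Nonempty ∧ IsCompact M ∧ IsTotallyDisconnected M ∧ Preperfect M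

/-- The system of all nonempty finite subsets and all Cantor subsets of `A`. -/
def finiteOrCantorSubsets {X : Type*} [TopologicalSpace X] (A : Set X) : Set (Set X) :=
  {M | M ⊆ A ∧ ((M.Nonempty ∧ M.Finite) ∨ IsCantorSet M)}

/-- An arc: homeomorphic to `[0,1]`. -/
def IsArc {X : Type*} [TopologicalSpace X] (A : Set X) : Prop :=
  Nonempty (A ≃ₜ Icc (0 : ℝ) 1)

/-- A ray: homeomorphic to `[0,∞)`. -/
def IsRay {X : Type*} [TopologicalSpace X] (A : Set X) : Prop :=
  Nonempty (A ≃ₜ Ici (0 : ℝ))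

/-- A free interval: an open set homeomorphic to `(0,1)`. -/
def IsFreeInterval {X : Type*} [TopologicalSpace X] (J : Set X) : Prop :=
  IsOpen J ∧ Nonempty (J ≃ₜ Ioo (0 : ℝ) 1)

/-- A locally connected continuum in a metrizable space. -/
def IsLocallyConnectedContinuum {X : Type*} [TopologicalSpace X] (K : Set X) : Prop :=
  IsCompact K ∧ IsConnected K ∧ LocallyConnectedSpace K

/-- The subspace `K` is a compactification of its subspace `S`. -/
def IsCompactificationOf {X : Type*} [TopologicalSpace X] (K S : Set X) : Prop :=
  IsCompact K ∧ S ⊆ K ∧ K ⊆ closure S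

/-- `X = L ∪ J ∪ R`, where `J` is a dense free interval and `L`, `R` are the locally connected left
and right remainders of `J`. -/
structure IsDecomposition {X : Type*} [TopologicalSpace X] (L J R : Set X) : Prop where
  union_eq : L ∪ J ∪ R = univ
  freeInterval : IsFreeInterval J
  dense : Dense J
  left_continuum : IsLocallyConnectedContinuum L
  right_continuum : IsLocallyConnectedContinuum R
  disjoint_left : Disjoint L J
  disjoint_right : Disjoint R J
  exists_rays : ∃ JL JR : Set X, IsRay JL ∧ IsRay JR ∧ J = JL ∪ JR ∧
    IsCompactificationOf (L ∪ JL) JL ∧ IsCompactificationOf (R ∪ JR) JR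

end DenseFreeInterval

open DenseFreeInterval

/-!
Fix a parametrization `φ : ℝ → X` of `J` for which `L` is the end at `-∞` and `R` the end at `+∞`
(`IsLine`).

*Obstructions.* A continuous image of a locally connected continuum cannot accumulate, within `J`, at
a nondegenerate end (`IsLine.exists_notMem_image`). Since `L`, `R` and the arcs in `J` are locally
connected continua, a selfmap `f` of `X` is severely restricted. Unless one end is a point of the
other, `f` maps each of the pieces (`L`, `R` and `J`; or `L` and `J ∪ R`; or `L ∪ R` and `J`) into a
single piece, so that a minimal set lies in one piece, or else in `L ∪ R` with `f` interchanging `L`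
and `R`; in the latter case `M ∩ L` and `M ∩ R` are images of each other. If `R` is a point of `L`,
then either `f` maps `L` into `L`, or the whole image of `f` lies in the union of `L` and an arc
(`IsLine.exists_forall_mem_union_arc`).

*Minimal sets in the line.* A minimal set contained in an arc is finite or a Cantor set, because an
interval in it would be mapped into itself by an iterate of `f`, which would give a periodic point
(`IsMinimalSetOf.finite_or_isCantorSet`). Conversely, finite sets carry cyclic permutations, Cantor
sets carry odometers (`exists_continuous_forall_dense_orbit`), and these maps extend to `X` by Tietze's
theorem with values in an arc.

*Retractions.* A minimal set of a subspace `A` is one of `X` if `A` is a retract of `X`. The retracts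
needed are `L`, `L ∪ R` (if `L` meets `R`) and `L ∪ A` with `A` an arc. They exist because a ray that
converges to a locally connected continuum is asymptotic to a path in it
(`IsLocallyConnectedContinuum.exists_ray_near`), so that the line can be pushed onto its ends. This
rests on the Mazurkiewicz–Moore–Menger theorem that a compact locally connected metric space is
uniformly locally path connected (`exists_uniform_small_path`).
-/

open Filter

/-! ### Odometers on Cantor sets -/

section Odometer
variable {C : Type*} [TopologicalSpace C]

/-- In a perfect zero-dimensional compact space every nonempty open set is cut into two nonempty
pieces by some clopen set. -/
theorem exists_isClopen_split [CompactSpace C] [T2Space C] [TotallyDisconnectedSpace C]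
    [PerfectSpace C] {D : Set C} (hD : IsOpen D) (hne : D.Nonempty) :
    ∃ V, IsClopen V ∧ (D ∩ V).Nonempty ∧ (D \ V).Nonempty := by
  obtain ⟨x, hx⟩ := hne
  obtain ⟨y, hy, hxy⟩ := preperfect_iff_nhds.1 (PerfectSpace.univ_preperfect (α := C)) x
    (mem_univ x) D (hD.mem_nhds hx)
  obtain ⟨V, hV, hxV, hyV⟩ := exists_isClopen_of_totally_separated (Ne.symm hxy)
  exact ⟨V, hV, ⟨x, hx, hxV⟩, y, hy.1, hyV⟩

theorem exists_seq_isClopen_basis [CompactSpace C] [T2Space C] [TotallyDisconnectedSpace C]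
    [SecondCountableTopology C] :
    ∃ U : ℕ → Set C, (∀ n, IsClopen (U n)) ∧
      ∀ x, ∀ W, IsOpen W → x ∈ W → ∃ n, x ∈ U n ∧ U n ⊆ W := by
  have := (TopologicalSpace.Clopens.countable_iff_secondCountable (X := C)).2 inferInstance
  obtain ⟨U, hU⟩ := exists_surjective_nat (TopologicalSpace.Clopens C)
  refine ⟨fun n => U n, fun n => (U n).isClopen, fun x W hW hx => ?_⟩
  obtain ⟨V, hV, hxV, hVW⟩ := (isTopologicalBasis_isClopen (X := C)).mem_nhds_iff.1 (hW.mem_nhds hx)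
  obtain ⟨n, hn⟩ := hU ⟨V, hV⟩
  exact ⟨n, by simp only [hn]; exact ⟨hxV, hVW⟩⟩

/-- A perfect zero-dimensional compact metrizable space carries a refining sequence of partitions
into `2 ^ n` nonempty clopen sets (the fibres of `a n`), compatible with reduction modulo `2 ^ n`,
that generates the topology. The `n`-th set of a countable clopen basis is used to cut every fibre
of `a n` that it splits properly, and the other fibres are cut arbitrarily. -/
theorem exists_dyadic_labels [CompactSpace C] [T2Space C] [TotallyDisconnectedSpace C]
    [SecondCountableTopology C] [PerfectSpace C] [Nonempty C] :
    ∃ a : ℕ → C → ℕ, (∀ n, IsLocallyConstant (a n)) ∧ (∀ n, range (a n) = Iio (2 ^ n)) ∧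
      (∀ n x, a (n + 1) x % 2 ^ n = a n x) ∧
      ∀ x, ∀ W, IsOpen W → x ∈ W → ∃ n, ∀ y, a n y = a n x → y ∈ W := by
  classical
  obtain ⟨U, hU, hb⟩ := exists_seq_isClopen_basis (C := C)
  have hsplit : ∀ n, ∀ D : Set C, ∃ V : Set C, IsClopen V ∧
      (IsOpen D → D.Nonempty → (D ∩ V).Nonempty ∧ (D \ V).Nonempty) ∧
      ((D ∩ V) = D ∩ U n ∨ D ⊆ U n ∨ D ∩ U n = ∅) := by
    intro n D
    by_cases h : (D ∩ U n).Nonempty ∧ (D \ U n).Nonempty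
    · exact ⟨U n, hU n, fun _ _ => h, Or.inl rfl⟩
    have h' : D ⊆ U n ∨ D ∩ U n = ∅ := by
      by_contra! h'
      exact h ⟨h'.2, by simpa [Set.Nonempty, Set.not_subset] using h'.1⟩
    by_cases hD : IsOpen D ∧ D.Nonempty
    · obtain ⟨V, hV, h1, h2⟩ := exists_isClopen_split hD.1 hD.2
      exact ⟨V, hV, fun _ _ => ⟨h1, h2⟩, Or.inr h'⟩
    · exact ⟨∅, isClopen_empty, fun h1 h2 => (hD ⟨h1, h2⟩).elim, Or.inr h'⟩
  choose V hV hVne hVU using hsplit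
  let a : ℕ → C → ℕ := fun n => Nat.rec (fun _ => 0)
    (fun n b x => b x + 2 ^ n * if x ∈ V n (b ⁻¹' {b x}) then 1 else 0) n
  have ha : ∀ n x, a (n + 1) x =
      a n x + 2 ^ n * if x ∈ V n (a n ⁻¹' {a n x}) then 1 else 0 := fun _ _ => rfl
  have hlc : ∀ n, IsLocallyConstant (a n) := by
    intro n
    induction n with
    | zero => exact IsLocallyConstant.const 0
    | succ n ih =>
      rw [IsLocallyConstant.iff_eventually_eq] at ih ⊢
      intro x
      have h2 : ∀ᶠ y in 𝓝 x, (y ∈ V n (a n ⁻¹' {a n x}) ↔ x ∈ V n (a n ⁻¹' {a n x})) := by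
        by_cases hx : x ∈ V n (a n ⁻¹' {a n x})
        · filter_upwards [(hV n _).isOpen.mem_nhds hx] with y hy using by simp [hy, hx]
        · filter_upwards [(hV n _).compl.isOpen.mem_nhds hx] with y hy
          simp only [hx, iff_false]; exact hy
      filter_upwards [ih x, h2] with y hy hy2
      simp only [ha, hy, hy2]
  have hrange : ∀ n, range (a n) = Iio (2 ^ n) := by
    intro n
    induction n with
    | zero =>
      have : a 0 = fun _ => 0 := rfl
      ext j; simp [this]
    | succ n ih =>
      ext j
      constructor
      · rintro ⟨x, rfl⟩
        have h1 : a n x < 2 ^ n := by have := mem_range_self (f := a n) x; rwa [ih] at this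
        rw [ha, mem_Iio, pow_succ]
        split_ifs <;> omega
      · intro hj
        have hj' : j < 2 ^ n * 2 := by simpa [pow_succ] using hj
        have h1 : j % 2 ^ n ∈ range (a n) := by rw [ih]; exact Nat.mod_lt _ (by positivity)
        obtain ⟨x, hx⟩ := h1
        obtain ⟨⟨y, hy1, hy2⟩, z, hz1, hz2⟩ := hVne n (a n ⁻¹' {a n x})
          ((hlc n).isOpen_fiber _) ⟨x, rfl⟩
        have hdm := Nat.mod_add_div j (2 ^ n)
        have hq : j / 2 ^ n = 0 ∨ j / 2 ^ n = 1 := by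
          have : j / 2 ^ n < 2 := Nat.div_lt_of_lt_mul hj'
          exact Nat.le_one_iff_eq_zero_or_eq_one.1 (Nat.lt_succ_iff.1 this)
        rcases hq with hq | hq <;> rw [hq] at hdm
        · refine ⟨z, ?_⟩
          have hz1 : a n z = a n x := hz1
          rw [ha, hz1, if_neg hz2, hx]; exact hdm
        · refine ⟨y, ?_⟩
          have hy1 : a n y = a n x := hy1
          rw [ha, hy1, if_pos hy2, hx]; exact hdm
  refine ⟨a, hlc, hrange, fun n x => ?_, fun x W hW hx => ?_⟩
  · have h1 : a n x < 2 ^ n := by have := mem_range_self (f := a n) x; rwa [hrange] at this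
    rw [ha, Nat.add_mul_mod_self_left, Nat.mod_eq_of_lt h1]
  · obtain ⟨n, hxn, hn⟩ := hb x W hW hx
    refine ⟨n + 1, fun y hy => hn ?_⟩
    have hbd : ∀ z, a n z < 2 ^ n := fun z => by
      have := mem_range_self (f := a n) z; rwa [hrange] at this
    have hxy : a n y = a n x := by
      have := congrArg (· % 2 ^ n) hy
      simpa only [ha, Nat.add_mul_mod_self_left, Nat.mod_eq_of_lt (hbd _)] using this
    have hmem : y ∈ V n (a n ⁻¹' {a n x}) ↔ x ∈ V n (a n ⁻¹' {a n x}) := by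
      simp only [ha, hxy] at hy
      by_cases h1 : y ∈ V n (a n ⁻¹' {a n x}) <;> by_cases h2 : x ∈ V n (a n ⁻¹' {a n x}) <;>
        simp_all
    rcases hVU n (a n ⁻¹' {a n x}) with h | h | h
    · have : x ∈ a n ⁻¹' {a n x} ∩ V n (a n ⁻¹' {a n x}) := by rw [h]; exact ⟨rfl, hxn⟩
      have : y ∈ a n ⁻¹' {a n x} ∩ V n (a n ⁻¹' {a n x}) := ⟨hxy, hmem.2 this.2⟩
      rw [h] at this
      exact this.2
    · exact h hxy
    · have : x ∈ a n ⁻¹' {a n x} ∩ U n := ⟨rfl, hxn⟩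
      rw [h] at this
      exact this.elim

/-- The dyadic odometer: a perfect zero-dimensional compact metrizable space has a continuous
selfmap all of whose orbits are dense. It adds one to the labels of `exists_dyadic_labels`. -/
theorem exists_continuous_forall_dense_orbit [CompactSpace C] [T2Space C]
    [TotallyDisconnectedSpace C] [SecondCountableTopology C] [PerfectSpace C] [Nonempty C] :
    ∃ f : C → C, Continuous f ∧ ∀ x, ∀ W, IsOpen W → W.Nonempty → ∃ k, f^[k] x ∈ W := by
  obtain ⟨a, hlc, hrange, hmod, hb⟩ := exists_dyadic_labels (C := C)
  -- the sets of points with the prescribed labels are nested, compact and nonempty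
  have hf : ∀ x, ∃ y, ∀ n, a n y = (a n x + 1) % 2 ^ n := by
    intro x
    have := IsCompact.nonempty_iInter_of_sequence_nonempty_isCompact_isClosed
      (fun n => {y | a n y = (a n x + 1) % 2 ^ n}) (fun n y hy => ?_) (fun n => ?_) ?_ (fun n => ?_)
    · obtain ⟨y, hy⟩ := this
      exact ⟨y, fun n => mem_iInter.1 hy n⟩
    · have hy : a (n + 1) y = (a (n + 1) x + 1) % 2 ^ (n + 1) := hy
      show a n y = (a n x + 1) % 2 ^ n
      rw [← hmod, hy, Nat.mod_mod_of_dvd _ (pow_dvd_pow 2 n.le_succ), ← hmod n x, Nat.mod_add_mod]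
    · show (_ : ℕ) ∈ range (a n)
      rw [hrange]; exact Nat.mod_lt _ (by positivity)
    · exact ((hlc 0).isClosed_fiber _).isCompact
    · exact (hlc n).isClosed_fiber _
  choose f hf using hf
  refine ⟨f, ?_, fun x W hW hne => ?_⟩
  · rw [continuous_iff_continuousAt]
    intro x W hW
    obtain ⟨W', hW', hWo, hxW⟩ := mem_nhds_iff.1 hW
    obtain ⟨n, hn⟩ := hb _ W' hWo hxW
    have hev := (IsLocallyConstant.iff_eventually_eq _).1 (hlc n) x
    show ∀ᶠ y in 𝓝 x, f y ∈ W
    filter_upwards [hev] with y hy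
    exact hW' (hn _ (by rw [hf, hf, hy]))
  · obtain ⟨w, hw⟩ := hne
    obtain ⟨n, hn⟩ := hb _ W hW hw
    have hk : ∀ k, a n (f^[k] x) = (a n x + k) % 2 ^ n := by
      intro k
      induction k with
      | zero =>
        have : a n x < 2 ^ n := by have := mem_range_self (f := a n) x; rwa [hrange] at this
        simp [Nat.mod_eq_of_lt this]
      | succ k ih => rw [Function.iterate_succ_apply', hf, ih, Nat.mod_add_mod, add_assoc]
    have h1 : a n x < 2 ^ n := by have := mem_range_self (f := a n) x; rwa [hrange] at this
    have h2 : a n w < 2 ^ n := by have := mem_range_self (f := a n) w; rwa [hrange] at this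
    refine ⟨a n w + (2 ^ n - a n x), hn _ ?_⟩
    rw [hk, show a n x + (a n w + (2 ^ n - a n x)) = a n w + 2 ^ n by omega,
      Nat.add_mod_right, Nat.mod_eq_of_lt h2]
end Odometer

/-! ### Minimal sets in subspaces and in arcs -/

section Dynamics
variable {X : Type*} [TopologicalSpace X]

/-- Members of `𝓜(A)` in terms of selfmaps of the ambient space; the values of `f` outside `A` are
irrelevant. -/
theorem mem_minimalSetsIn_iff [T2Space X] {A M : Set X} :
    M ∈ minimalSetsIn A ↔
      M ⊆ A ∧ ∃ f : X → X, ContinuousOn f A ∧ MapsTo f A A ∧ IsMinimalSetOf f M := by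
  classical
  constructor
  · rintro ⟨M', ⟨f, hf, hne, hcomp, himg, hmin⟩, rfl⟩
    have hF : ∀ x : A, (fun x => if h : x ∈ A then (f ⟨x, h⟩ : X) else x) x = f x := by
      rintro ⟨x, hx⟩; simp [hx]
    refine ⟨Subtype.coe_image_subset _ _, fun x => if h : x ∈ A then (f ⟨x, h⟩ : X) else x,
      ?_, ?_, hne.image _, hcomp.image continuous_subtype_val, ?_, ?_⟩
    · rw [continuousOn_iff_continuous_domRestrict]
      exact (continuous_subtype_val.comp hf).congr fun x => (hF x).symm
    · intro x hx
      rw [hF ⟨x, hx⟩]; exact (f ⟨x, hx⟩).2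
    · rw [image_image]
      simp only [hF]
      conv_rhs => rw [← himg]
      rw [image_image]
    · intro N hNM hN hNc hfN
      have hNA : N ⊆ A := hNM.trans (Subtype.coe_image_subset _ _)
      have := hmin (Subtype.val ⁻¹' N) ?_ ?_ (hNc.preimage continuous_subtype_val) ?_
      · show N = Subtype.val '' M'
        rw [← this, Subtype.image_preimage_coe, inter_eq_right.2 hNA]
      · intro x hx
        obtain ⟨y, hy, hyx⟩ := hNM hx
        rwa [← Subtype.ext hyx]
      · obtain ⟨x, hx⟩ := hN
        exact ⟨⟨x, hNA hx⟩, hx⟩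
      · intro x hx
        have := hfN hx
        rwa [hF x] at this
  · rintro ⟨hMA, f, hf, hmaps, hne, hcomp, himg, hmin⟩
    have hval : Subtype.val '' (Subtype.val ⁻¹' M : Set A) = M := by
      rw [Subtype.image_preimage_coe, inter_eq_right.2 hMA]
    have hcomp' : IsCompact (Subtype.val ⁻¹' M : Set A) := by
      rwa [Subtype.isCompact_iff, hval]
    refine ⟨Subtype.val ⁻¹' M, ⟨hmaps.restrict f A A, hf.mapsToRestrict hmaps, ?_, hcomp', ?_, ?_⟩,
      hval⟩
    · obtain ⟨x, hx⟩ := hne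
      exact ⟨⟨x, hMA hx⟩, hx⟩
    · apply Subtype.val_injective.image_injective
      rw [image_image, hval]
      simp only [MapsTo.val_restrict_apply]
      rw [← image_image f Subtype.val, hval, himg]
    · intro N hNM hN hNc hfN
      have := hmin (Subtype.val '' N) ?_ (hN.image _)
        ((hcomp'.of_isClosed_subset hNc hNM).image continuous_subtype_val).isClosed ?_
      · rw [← this, preimage_image_eq _ Subtype.val_injective]
      · rw [← hval]; exact image_mono hNM
      · rintro _ ⟨x, hx, rfl⟩
        exact ⟨_, hfN hx, rfl⟩

namespace DenseFreeInterval.IsMinimalSetOf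
variable {f : X → X} {M : Set X}

theorem mapsTo (h : IsMinimalSetOf f M) : MapsTo f M M := fun x hx => by
  rw [← h.2.2.1]; exact mem_image_of_mem f hx

theorem congr {g : X → X} (h : IsMinimalSetOf f M) (hfg : EqOn f g M) : IsMinimalSetOf g M :=
  ⟨h.1, h.2.1, by rw [← hfg.image_eq, h.2.2.1], fun N hN hne hc hm =>
    h.2.2.2 N hN hne hc fun x hx => by rw [hfg (hN hx)]; exact hm hx⟩

/-- A minimal set that meets a closed invariant set is contained in it. -/
theorem subset_of_mapsTo [T2Space X] (h : IsMinimalSetOf f M) {K : Set X} (hK : IsClosed K)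
    (hm : MapsTo f (M ∩ K) K) (hne : (M ∩ K).Nonempty) : M ⊆ K := by
  have := h.2.2.2 (M ∩ K) inter_subset_left hne (h.2.1.isClosed.inter hK)
    fun x hx => ⟨h.mapsTo hx.1, hm hx⟩
  rw [← this]; exact inter_subset_right

/-- Every forward orbit in a minimal set, without its starting point, is dense. -/
theorem exists_iterate_mem [T2Space X] (h : IsMinimalSetOf f M) (hf : ContinuousOn f M)
    {x : X} (hx : x ∈ M) {W : Set X} (hW : IsOpen W) (hne : (M ∩ W).Nonempty) :
    ∃ n, 0 < n ∧ f^[n] x ∈ W := by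
  have hit : ∀ n, f^[n] x ∈ M := fun n => h.mapsTo.iterate n hx
  have hsub : closure (range fun n => f^[n + 1] x) ⊆ M :=
    closure_minimal (range_subset_iff.2 fun n => hit _) h.2.1.isClosed
  have hmaps : MapsTo f (closure (range fun n => f^[n + 1] x))
      (closure (range fun n => f^[n + 1] x)) := by
    refine MapsTo.closure_of_continuousOn ?_ (hf.mono hsub)
    rintro _ ⟨n, rfl⟩
    exact ⟨n + 1, by simp only [Function.iterate_succ_apply']⟩
  have := h.2.2.2 _ hsub (range_nonempty _).closure isClosed_closure hmaps
  obtain ⟨y, hyM, hyW⟩ := hne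
  rw [← this] at hyM
  obtain ⟨_, hz, n, rfl⟩ := mem_closure_iff.1 hyM W hW hyW
  exact ⟨n + 1, n.succ_pos, hz⟩

theorem finite_of_periodic [T1Space X] (h : IsMinimalSetOf f M) {x : X} (hx : x ∈ M) {n : ℕ}
    (hn : 0 < n) (hp : f^[n] x = x) : M.Finite := by
  have hfin : ((fun k => f^[k] x) '' Iio n).Finite := (finite_Iio n).image _
  have := h.2.2.2 _ (?_ : (fun k => f^[k] x) '' Iio n ⊆ M) ⟨x, 0, hn, rfl⟩ hfin.isClosed ?_
  · rwa [← this]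
  · rintro _ ⟨k, -, rfl⟩
    exact h.mapsTo.iterate k hx
  · rintro _ ⟨k, hk, rfl⟩
    rcases (Nat.succ_le_of_lt hk).lt_or_eq with hk | hk
    · exact ⟨k + 1, hk, by simp only [Function.iterate_succ_apply']⟩
    · refine ⟨0, hn, ?_⟩
      simp only [← Function.iterate_succ_apply' f, Function.iterate_zero, id]
      rw [hk, hp]

/-- An isolated point of a minimal set returns to itself, so it is periodic. -/
theorem finite_or_preperfect [T2Space X] (h : IsMinimalSetOf f M) (hf : ContinuousOn f M) :
    M.Finite ∨ Preperfect M := by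
  refine or_iff_not_imp_right.2 fun hp => ?_
  rw [preperfect_iff_nhds] at hp
  push Not at hp
  obtain ⟨x, hx, U, hU, hUx⟩ := hp
  obtain ⟨W, hWU, hWo, hxW⟩ := mem_nhds_iff.1 hU
  obtain ⟨n, hn, hnW⟩ := h.exists_iterate_mem hf hx hWo ⟨x, hx, hxW⟩
  exact h.finite_of_periodic hx hn (hUx _ ⟨hWU hnW, h.mapsTo.iterate n hx⟩)

/-- A minimal set that embeds in the line is finite or a Cantor set: a nondegenerate component is an
interval with nonempty interior, so some iterate of `f` maps it into itself and has a fixed point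
there. -/
theorem finite_or_isCantorSet [T2Space X] (h : IsMinimalSetOf f M) (hf : ContinuousOn f M)
    {ψ : X → ℝ} (hψ : ContinuousOn ψ M) (hinj : InjOn ψ M) : M.Finite ∨ IsCantorSet M := by
  refine or_iff_not_imp_left.2 fun hfin =>
    ⟨h.1, h.2.1, fun C hCM hC => ?_, (h.finite_or_preperfect hf).resolve_left hfin⟩
  by_contra hnt
  rw [not_subsingleton_iff] at hnt
  refine hfin ?_
  obtain ⟨c, hc⟩ := hnt.nonempty
  have hcM := hCM hc
  have : Nonempty X := ⟨c⟩
  set I := connectedComponentIn M c with hI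
  have hIM : I ⊆ M := connectedComponentIn_subset M c
  have hCI : C ⊆ I := hC.subset_connectedComponentIn hc hCM
  have hIconn : IsConnected I := isConnected_connectedComponentIn_iff.2 hcM
  have hIc : IsCompact I := by
    refine h.2.1.of_isClosed_subset (isClosed_of_closure_subset ?_) hIM
    exact hIconn.isPreconnected.closure.subset_connectedComponentIn
      (subset_closure (mem_connectedComponentIn hcM)) (closure_minimal hIM h.2.1.isClosed)
  -- the image of `I` is an interval `[p, q]`
  obtain ⟨p, q, hpq, himg⟩ : ∃ p q, p < q ∧ ψ '' I = Icc p q := by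
    have h1 := eq_Icc_of_connected_compact (hIconn.image ψ (hψ.mono hIM))
      (hIc.image_of_continuousOn (hψ.mono hIM))
    refine ⟨_, _, ?_, h1⟩
    by_contra! hle
    obtain ⟨x, hx, y, hy, hxy⟩ := hnt
    have hs : (ψ '' I).Subsingleton := by
      rw [h1]; exact subsingleton_Icc_of_ge hle
    exact hxy (hinj (hCM hx) (hCM hy)
      (hs (mem_image_of_mem _ (hCI hx)) (mem_image_of_mem _ (hCI hy))))
  have hmemI : ∀ x ∈ M, ψ x ∈ Icc p q → x ∈ I := by
    intro x hx hxpq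
    rw [← himg] at hxpq
    obtain ⟨y, hy, hyx⟩ := hxpq
    rwa [← hinj (hIM hy) hx hyx]
  -- some iterate of `f` maps `I` into itself
  obtain ⟨n, hn, hmaps⟩ : ∃ n, 0 < n ∧ MapsTo f^[n] I I := by
    obtain ⟨W, hW, hWeq⟩ := continuousOn_iff'.1 hψ (Ioo p q) isOpen_Ioo
    obtain ⟨t, ht⟩ := exists_between hpq
    obtain ⟨x, hx, rfl⟩ : t ∈ ψ '' I := by rw [himg]; exact Ioo_subset_Icc_self ht
    have hxW : x ∈ W ∩ M := by rw [← hWeq]; exact ⟨ht, hIM hx⟩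
    obtain ⟨n, hn, hnW⟩ := h.exists_iterate_mem hf (hIM hx) hW ⟨x, hxW.2, hxW.1⟩
    have hnM : f^[n] x ∈ M := h.mapsTo.iterate n (hIM hx)
    have hnI : f^[n] x ∈ I := hmemI _ hnM (Ioo_subset_Icc_self
      (by have : f^[n] x ∈ W ∩ M := ⟨hnW, hnM⟩
          rw [← hWeq] at this; exact this.1))
    refine ⟨n, hn, mapsTo_iff_image_subset.2 ?_⟩
    have hcomp : I = connectedComponentIn M (f^[n] x) := connectedComponentIn_eq hnI
    conv_rhs => rw [hcomp]
    exact (hIconn.isPreconnected.image _ ((hf.iterate h.mapsTo n).mono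
      hIM)).subset_connectedComponentIn (mem_image_of_mem _ hx)
      ((h.mapsTo.iterate n).mono_left hIM).image_subset
  -- hence it has a fixed point in `I`
  have hg : ContinuousOn (Function.invFunOn ψ M) (ψ '' M) := by
    rw [continuousOn_iff_isClosed]
    intro K hK
    refine ⟨ψ '' (M ∩ K), ((h.2.1.inter_right hK).image_of_continuousOn
      (hψ.mono inter_subset_left)).isClosed, ?_⟩
    ext t
    constructor
    · rintro ⟨ht, x, hx, rfl⟩
      rw [mem_preimage, hinj.leftInvOn_invFunOn hx] at ht
      exact ⟨⟨x, ⟨hx, ht⟩, rfl⟩, x, hx, rfl⟩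
    · rintro ⟨⟨x, ⟨hx, hxK⟩, rfl⟩, -⟩
      refine ⟨?_, x, hx, rfl⟩
      rwa [mem_preimage, hinj.leftInvOn_invFunOn hx]
  have hgI : MapsTo (Function.invFunOn ψ M) (Icc p q) I := by
    rw [← himg]
    rintro _ ⟨x, hx, rfl⟩
    rwa [hinj.leftInvOn_invFunOn (hIM hx)]
  have hsub : Icc p q ⊆ ψ '' M := himg ▸ image_mono hIM
  have hcont : ContinuousOn (fun t => ψ (f^[n] (Function.invFunOn ψ M t))) (Icc p q) :=
    (hψ.mono hIM).comp (((hf.iterate h.mapsTo n).mono hIM).comp (hg.mono hsub) hgI)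
      fun s hs => hmaps (hgI hs)
  obtain ⟨t, ht, htfix⟩ := exists_mem_Icc_isFixedPt_of_mapsTo hcont hpq.le
    fun s hs => himg ▸ mem_image_of_mem ψ (hmaps (hgI hs))
  have hx := hgI ht
  exact h.finite_of_periodic (hIM hx) hn (hinj (hIM (hmaps hx)) (hIM hx)
    (htfix.trans (Function.invFunOn_eq (hsub ht)).symm))
end DenseFreeInterval.IsMinimalSetOf

/-- Every nonempty finite set and every Cantor set carries a minimal map. -/
theorem exists_isMinimalSetOf [TopologicalSpace.MetrizableSpace X] {M : Set X}
    (hM : (M.Nonempty ∧ M.Finite) ∨ IsCantorSet M) :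
    ∃ f : X → X, ContinuousOn f M ∧ IsMinimalSetOf f M := by
  classical
  rcases hM with ⟨hne, hfin⟩ | ⟨hne, hcomp, htd, hp⟩
  · obtain ⟨σ, hσ, -⟩ := hfin.countable.exists_cycleOn
    refine ⟨σ, hfin.continuousOn _, hne, hfin.isCompact, hσ.1.image_eq, ?_⟩
    rintro N hNM ⟨x, hx⟩ - hN
    refine hNM.antisymm fun y hy => ?_
    obtain ⟨n, hn⟩ := hσ.exists_pow_eq' hfin (hNM hx) hy
    rw [← hn, ← Equiv.Perm.iterate_eq_pow]
    exact hN.iterate n hx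
  · have : CompactSpace M := isCompact_iff_compactSpace.1 hcomp
    have : TotallyDisconnectedSpace M := totallyDisconnectedSpace_subtype_iff.2 htd
    have : Nonempty M := hne.to_subtype
    have : PerfectSpace M := by
      refine ⟨preperfect_iff_nhds.2 fun x _ U hU => ?_⟩
      obtain ⟨V, hV, hVU⟩ := mem_nhds_subtype _ _ _ |>.1 hU
      obtain ⟨y, hy, hyx⟩ := preperfect_iff_nhds.1 hp x x.2 V hV
      exact ⟨⟨y, hy.2⟩, ⟨hVU hy.1, mem_univ _⟩, fun h => hyx (congrArg Subtype.val h)⟩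
    let := TopologicalSpace.metrizableSpaceMetric X
    obtain ⟨f, hf, hd⟩ := exists_continuous_forall_dense_orbit (C := M)
    have hmin : IsMinimalSetOf f univ := by
      have hdense : ∀ N : Set M, N.Nonempty → IsClosed N → MapsTo f N N → N = univ := by
        rintro N ⟨x, hx⟩ hc hN
        by_contra hne
        obtain ⟨k, hk⟩ := hd x Nᶜ hc.isOpen_compl (nonempty_compl.2 hne)
        exact hk (hN.iterate k hx)
      refine ⟨univ_nonempty, isCompact_univ, ?_, fun N _ => hdense N⟩
      refine hdense _ (univ_nonempty.image f) (isCompact_univ.image hf).isClosed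
        fun x _ => mem_image_of_mem f (mem_univ x)
    obtain ⟨-, F, hF, -, hmin⟩ := mem_minimalSetsIn_iff.1 (⟨univ, ⟨f, hf, hmin⟩, rfl⟩ :
      Subtype.val '' (univ : Set M) ∈ minimalSetsIn M)
    rw [Subtype.coe_image_univ] at hmin
    exact ⟨F, hF, hmin⟩

theorem tietzeExtension_of_isArc {P : Set X} (hP : IsArc P) : TietzeExtension.{u_1, u_1} P := by
  obtain ⟨e⟩ := hP
  exact .of_homeo e

/-- A finite or Cantor set in an arc `P ⊆ A` belongs to `𝓜(A)`: by Tietze's theorem, a minimal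
selfmap of it extends to a map of the whole space into `P`. -/
theorem mem_minimalSetsIn_of_subset_arc [TopologicalSpace.MetrizableSpace X] {M P A : Set X}
    (hM : (M.Nonempty ∧ M.Finite) ∨ IsCantorSet M) (hP : IsArc P) (hMP : M ⊆ P) (hPA : P ⊆ A) :
    M ∈ minimalSetsIn A := by
  let := TopologicalSpace.metrizableSpaceMetric X
  obtain ⟨f, hf, hmin⟩ := exists_isMinimalSetOf hM
  have := tietzeExtension_of_isArc hP
  obtain ⟨g, hg, hgf⟩ := ContinuousMap.exists_forall_mem_restrict_eq hmin.2.1.isClosed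
    ⟨M.domRestrict f, continuousOn_iff_continuous_domRestrict.1 hf⟩ (t := P)
    fun x => hMP (hmin.mapsTo x.2)
  refine mem_minimalSetsIn_iff.2 ⟨hMP.trans hPA, g, g.continuous.continuousOn,
    fun x _ => hPA (hg x), hmin.congr fun x hx => ?_⟩
  exact (congrArg (fun h : C(M, X) => h ⟨x, hx⟩) hgf).symm

theorem minimalSetsIn_univ [T2Space X] : minimalSetsIn (univ : Set X) = minimalSets X := by
  ext M
  simp [mem_minimalSetsIn_iff, minimalSets, continuousOn_univ, mapsTo_univ]
end Dynamics

/-! ### Peano continua are uniformly locally path connected -/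

section Peano
variable {K : Type*} [MetricSpace K]

/-- Any two points of a preconnected set are joined by a chain with arbitrarily small steps. -/
theorem IsPreconnected.exists_chain {C : Set K} (hC : IsPreconnected C) {δ : ℝ} (hδ : 0 < δ)
    {x y : K} (hx : x ∈ C) (hy : y ∈ C) :
    ∃ (n : ℕ) (c : ℕ → K), c 0 = x ∧ (∀ i ≥ n, c i = y) ∧ (∀ i, c i ∈ C) ∧
      ∀ i, dist (c i) (c (i + 1)) < δ := by
  have key : Relation.ReflTransGen (fun a b => a ∈ C ∧ b ∈ C ∧ dist a b < δ) x y := by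
    refine hC.induction₂' _ (fun a ha => ?_) (fun _ _ _ _ _ _ h1 h2 => h1.trans h2) hx hy
    filter_upwards [self_mem_nhdsWithin, mem_nhdsWithin_of_mem_nhds (Metric.ball_mem_nhds a hδ)]
      with b hb hab
    have hab' : dist b a < δ := hab
    exact ⟨.single ⟨ha, hb, by rwa [dist_comm]⟩, .single ⟨hb, ha, hab'⟩⟩
  clear hx
  induction key using Relation.ReflTransGen.head_induction_on with
  | refl => exact ⟨0, fun _ => y, rfl, fun _ _ => rfl, fun _ => hy, fun _ => by simpa using hδ⟩
  | @head a b h _ ih =>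
    obtain ⟨n, c, h0, hn, hcC, hcd⟩ := ih
    refine ⟨n + 1, fun i => Nat.casesOn i a c, rfl, ?_, ?_, ?_⟩
    · rintro (_ | i) hi
      · omega
      · exact hn i (by omega)
    · rintro (_ | i)
      exacts [h.1, hcC i]
    · rintro (_ | i)
      · show dist _ (c 0) < δ
        rw [h0]; exact h.2.2
      · exact hcd i

/-- In a compact space the number of steps can be chosen uniformly for all pairs of points. -/
theorem IsPreconnected.exists_uniform_chain [CompactSpace K] {C : Set K} (hC : IsPreconnected C)
    {δ : ℝ} (hδ : 0 < δ) :
    ∃ N : ℕ, ∀ x ∈ C, ∀ y ∈ C, ∃ c : ℕ → K, c 0 = x ∧ (∀ i ≥ N, c i = y) ∧ (∀ i, c i ∈ C) ∧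
      ∀ i, dist (c i) (c (i + 1)) < δ := by
  obtain ⟨t, htC, htf, hcov⟩ := Metric.finite_approx_of_totallyBounded
    ((isCompact_univ (X := K)).totallyBounded.subset (subset_univ C)) δ hδ
  have h1 : ∀ p : K × K, ∃ n : ℕ, p.1 ∈ C → p.2 ∈ C → ∃ c : ℕ → K, c 0 = p.1 ∧
      (∀ i ≥ n, c i = p.2) ∧ (∀ i, c i ∈ C) ∧ ∀ i, dist (c i) (c (i + 1)) < δ := by
    intro p
    by_cases h : p.1 ∈ C ∧ p.2 ∈ C
    · obtain ⟨n, hn⟩ := hC.exists_chain hδ h.1 h.2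
      exact ⟨n, fun _ _ => hn⟩
    · exact ⟨0, fun h1 h2 => (h ⟨h1, h2⟩).elim⟩
  choose n hn using h1
  obtain ⟨N, hN⟩ := ((htf.prod htf).image n).bddAbove
  refine ⟨N + 2, fun x hx y hy => ?_⟩
  obtain ⟨a, hat, hxa⟩ := mem_iUnion₂.1 (hcov hx)
  obtain ⟨b, hbt, hyb⟩ := mem_iUnion₂.1 (hcov hy)
  obtain ⟨c, h0, hcn, hcC, hcd⟩ := hn (a, b) (htC hat) (htC hbt)
  have hle : n (a, b) ≤ N := hN ⟨(a, b), ⟨hat, hbt⟩, rfl⟩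
  refine ⟨fun i => Nat.casesOn i x fun j => if j ≤ N then c j else y, rfl, ?_, ?_, ?_⟩
  · rintro (_ | i) hi
    · omega
    · exact if_neg (by omega)
  · rintro (_ | i)
    · exact hx
    · show (if i ≤ N then c i else y) ∈ C
      split_ifs
      exacts [hcC i, hy]
  · rintro (_ | i)
    · simpa [h0] using hxa
    · show dist (if i ≤ N then c i else y) (if i + 1 ≤ N then c (i + 1) else y) < δ
      split_ifs with h1 h2 h2
      · exact hcd i
      · have : c i = b := hcn i (by omega)
        rw [this, dist_comm]; exact hyb
      · omega
      · simpa using hδ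

/-- A compact locally connected metric space is uniformly locally connected, in the form of chains:
points at distance less than `δ` are joined, inside a ball of radius `ε`, by chains with arbitrarily
small steps, whose length depends on the size of the steps only. -/
theorem exists_uniform_small_chain [CompactSpace K] [LocallyConnectedSpace K] {ε : ℝ}
    (hε : 0 < ε) :
    ∃ δ > 0, ∀ δ' > 0, ∃ N : ℕ, ∀ x y : K, dist x y < δ → ∃ c : ℕ → K, c 0 = x ∧
      (∀ i ≥ N, c i = y) ∧ (∀ i, dist (c i) x ≤ ε) ∧ ∀ i, dist (c i) (c (i + 1)) < δ' := by
  have h1 : ∀ z : K, ∃ C : Set K, C ∈ 𝓝 z ∧ IsPreconnected C ∧ C ⊆ Metric.ball z (ε / 2) := by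
    intro z
    obtain ⟨V, ⟨hVo, hzV, hV⟩, hVs⟩ := (LocallyConnectedSpace.open_connected_basis z).mem_iff.1
      (Metric.ball_mem_nhds z (half_pos hε))
    exact ⟨V, hVo.mem_nhds hzV, hV.isPreconnected, hVs⟩
  choose C hCn hC hCb using h1
  obtain ⟨t, ht⟩ := isCompact_univ.elim_nhds_subcover' (fun z _ => interior (C z))
    fun z _ => interior_mem_nhds.2 (hCn z)
  obtain ⟨δ, hδ, hδC⟩ := lebesgue_number_lemma_of_metric (isCompact_univ (X := K))
    (c := fun i : t => interior (C i.1.1)) (fun i => isOpen_interior)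
    (fun x hx => by
      obtain ⟨i, hi, hxi⟩ := mem_iUnion₂.1 (ht hx)
      exact mem_iUnion.2 ⟨⟨i, hi⟩, hxi⟩)
  refine ⟨δ, hδ, fun δ' hδ' => ?_⟩
  choose N hN using fun z => (hC z).exists_uniform_chain hδ'
  obtain ⟨M, hM⟩ := (finite_range fun i : t => N i.1.1).bddAbove
  refine ⟨M, fun x y hxy => ?_⟩
  obtain ⟨i, hi⟩ := hδC x (mem_univ x)
  have hx : x ∈ C i.1.1 := interior_subset (hi (Metric.mem_ball_self hδ))
  have hy : y ∈ C i.1.1 := interior_subset (hi (by rwa [Metric.mem_ball, dist_comm]))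
  obtain ⟨c, h0, hcn, hcC, hcd⟩ := hN _ x hx y hy
  refine ⟨c, h0, fun j hj => hcn j (le_trans (hM ⟨i, rfl⟩) hj), fun j => ?_, hcd⟩
  have h1 : dist (c j) i.1.1 < ε / 2 := hCb _ (hcC j)
  have h2 : dist x i.1.1 < ε / 2 := hCb _ hx
  linarith [dist_triangle_right (c j) x i.1.1]

/-- **Mazurkiewicz–Moore–Menger theorem**, uniform version: in a compact locally connected metric
space, points that are close together are joined by small paths.

The chain `g k`, of length `D k`, is refined by replacing each of its steps by a chain of `N k` steps
of smaller size; the path is the uniform limit of the step functions `t ↦ g k ⌊t * D k⌋₊`. Refining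
every step into the same number of pieces keeps the parametrizations compatible. -/
theorem exists_uniform_small_path [CompactSpace K] [LocallyConnectedSpace K] {ε : ℝ}
    (hε : 0 < ε) :
    ∃ δ > 0, ∀ x y : K, dist x y < δ → ∃ γ : Path x y, ∀ t, dist (γ t) x ≤ ε := by
  have hεk : ∀ k : ℕ, 0 < ε / 2 / 2 ^ k := fun k => by positivity
  choose δ₀ hδ₀ H using fun k => exists_uniform_small_chain (K := K) (hεk k)
  set δ : ℕ → ℝ := fun k => min (δ₀ k) (ε / 2 / 2 ^ k) with hδdef
  have hδ : ∀ k, 0 < δ k := fun k => lt_min (hδ₀ k) (hεk k)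
  choose N₀ hN₀ using fun k => H k (δ (k + 1)) (hδ (k + 1))
  set N : ℕ → ℕ := fun k => N₀ k + 1 with hNdef
  have hc : ∀ k (x y : K), ∃ c : ℕ → K, dist x y < δ k → c 0 = x ∧ c (N k) = y ∧
      (∀ i, dist (c i) x ≤ ε / 2 / 2 ^ k) ∧ ∀ i, dist (c i) (c (i + 1)) < δ (k + 1) := by
    intro k x y
    by_cases h : dist x y < δ k
    · obtain ⟨c, h0, h1, h2, h3⟩ := hN₀ k x y (h.trans_le (min_le_left _ _))
      exact ⟨c, fun _ => ⟨h0, h1 _ (Nat.le_succ _), h2, h3⟩⟩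
    · exact ⟨fun _ => x, fun h' => (h h').elim⟩
  choose c hc using hc
  refine ⟨δ 0, hδ 0, fun x y hxy => ?_⟩
  let g : ℕ → ℕ → K := fun k => Nat.rec (fun n => if n = 0 then x else y)
    (fun k g n => c k (g (n / N k)) (g (n / N k + 1)) (n % N k)) k
  have hg : ∀ k n, g (k + 1) n = c k (g k (n / N k)) (g k (n / N k + 1)) (n % N k) :=
    fun _ _ => rfl
  let D : ℕ → ℕ := fun k => Nat.rec 1 (fun k d => d * N k) k
  have hD : ∀ k, D (k + 1) = D k * N k := fun _ => rfl
  have hD0 : D 0 = 1 := rfl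
  have hg00 : ∀ n, g 0 n = if n = 0 then x else y := fun _ => rfl
  clear_value D g
  have hNpos : ∀ k, 0 < N k := fun k => Nat.succ_pos _
  have hDpos : ∀ k, 0 < D k := by
    intro k
    induction k with
    | zero => rw [hD0]; exact Nat.one_pos
    | succ k ih => rw [hD]; exact Nat.mul_pos ih (hNpos k)
  have hstep : ∀ k n, dist (g k n) (g k (n + 1)) < δ k := by
    intro k
    induction k with
    | zero =>
      rintro (_ | n)
      · simpa [hg00] using hxy
      · simpa [hg00] using hδ 0
    | succ k ih =>
      intro n
      obtain ⟨h0, h1, -, h3⟩ := hc k _ _ (ih (n / N k))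
      rw [hg k n]
      have hlt := Nat.mod_lt n (hNpos k)
      have hdm := Nat.div_add_mod n (N k)
      rcases Nat.lt_or_ge (n % N k + 1) (N k) with h | h
      · have e1 : (n + 1) / N k = n / N k := by
          conv_lhs => rw [← hdm, add_assoc, add_comm]
          rw [Nat.add_mul_div_left _ _ (hNpos k), Nat.div_eq_of_lt h, zero_add]
        have e2 : (n + 1) % N k = n % N k + 1 := by
          rw [Nat.add_mod_eq_add_mod_right 1 (Nat.mod_mod n (N k)).symm, Nat.mod_eq_of_lt h]
        rw [hg k (n + 1), e1, e2]
        exact h3 _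
      · have e0 : n + 1 = N k * (n / N k + 1) := by rw [mul_add, mul_one]; omega
        have e1 : (n + 1) / N k = n / N k + 1 := by
          rw [e0, Nat.mul_div_cancel_left _ (hNpos k)]
        have e2 : (n + 1) % N k = 0 := by rw [e0, Nat.mul_mod_right]
        have e3 : n % N k + 1 = N k := by omega
        obtain ⟨h0', -⟩ := hc k _ _ (ih (n / N k + 1))
        have h4 := h3 (n % N k)
        rw [e3, h1] at h4
        rwa [hg k (n + 1), e1, e2, h0']
  have hg0 : ∀ k, g k 0 = x := by
    intro k
    induction k with
    | zero => simp [hg00]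
    | succ k ih =>
      rw [hg, Nat.zero_mod, Nat.zero_div, (hc k _ _ (hstep k 0)).1, ih]
  have hgD : ∀ k, g k (D k) = y := by
    intro k
    induction k with
    | zero => simp [hg00, hD0]
    | succ k ih =>
      rw [hg, hD, Nat.mul_mod_left, Nat.mul_div_cancel _ (hNpos k), (hc k _ _ (hstep k _)).1, ih]
  have hG : ∀ (t : ℝ) (k : ℕ),
      dist (g k ⌊t * (D k : ℝ)⌋₊) (g (k + 1) ⌊t * (D (k + 1) : ℝ)⌋₊) ≤ ε / 2 / 2 ^ k := by
    intro t k
    have e : ⌊t * (D (k + 1) : ℝ)⌋₊ / N k = ⌊t * (D k : ℝ)⌋₊ := by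
      rw [← Nat.floor_div_natCast, hD, Nat.cast_mul, ← mul_assoc,
        mul_div_cancel_right₀ _ (Nat.cast_ne_zero.2 (hNpos k).ne')]
    rw [dist_comm, hg, e]
    exact (hc k _ _ (hstep k _)).2.2.1 _
  choose γ hγ using fun t : ℝ => cauchySeq_tendsto_of_complete
    (cauchySeq_of_le_geometric_two (hG t))
  have hγd : ∀ (t : ℝ) (k : ℕ), dist (g k ⌊t * (D k : ℝ)⌋₊) (γ t) ≤ ε / 2 ^ k := fun t k =>
    dist_le_of_le_geometric_two_of_tendsto (hG t) (hγ t) k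
  have hγ0 : γ 0 = x := by
    refine tendsto_nhds_unique (hγ 0) ?_
    simp [hg0]
  have hγ1 : γ 1 = y := by
    refine tendsto_nhds_unique (hγ 1) ?_
    simp [hgD]
  have hfloor : ∀ (k : ℕ) (s t : ℝ), s ≤ t → t < s + 1 / D k →
      dist (g k ⌊s * (D k : ℝ)⌋₊) (g k ⌊t * (D k : ℝ)⌋₊) < δ k := by
    intro k s t hst hts
    have hpos : (0 : ℝ) < D k := Nat.cast_pos.2 (hDpos k)
    have h1 : ⌊s * (D k : ℝ)⌋₊ ≤ ⌊t * (D k : ℝ)⌋₊ := Nat.floor_mono (by gcongr)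
    have h2 : ⌊t * (D k : ℝ)⌋₊ ≤ ⌊s * (D k : ℝ)⌋₊ + 1 := by
      have h3 : t * (D k : ℝ) ≤ s * (D k : ℝ) + 1 := by
        have := mul_le_mul_of_nonneg_right hts.le hpos.le
        rwa [add_mul, one_div, inv_mul_cancel₀ hpos.ne'] at this
      rcases le_or_gt 0 (s * (D k : ℝ)) with h0 | h0
      · rw [← Nat.floor_add_one h0]
        exact Nat.floor_mono h3
      · refine (Nat.floor_mono h3).trans ((Nat.floor_mono (?_ : _ ≤ (1 : ℝ))).trans ?_)
        · linarith
        · simp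
    rcases Nat.eq_or_lt_of_le h1 with h | h
    · rw [h, dist_self]; exact hδ k
    · rw [show ⌊t * (D k : ℝ)⌋₊ = ⌊s * (D k : ℝ)⌋₊ + 1 by omega]
      exact hstep k _
  have hcont : Continuous γ := by
    rw [Metric.continuous_iff]
    intro t η hη
    obtain ⟨k, hk⟩ : ∃ k : ℕ, 3 * ε / 2 ^ k < η := by
      obtain ⟨k, hk⟩ := exists_pow_lt_of_lt_one (show 0 < η / (3 * ε) by positivity)
        (show (1 / 2 : ℝ) < 1 by norm_num)
      refine ⟨k, ?_⟩
      rw [lt_div_iff₀ (by positivity), one_div, inv_pow] at hk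
      rwa [div_eq_inv_mul]
    have hpos : (0 : ℝ) < 1 / D k := by
      have : (0 : ℝ) < D k := Nat.cast_pos.2 (hDpos k)
      positivity
    refine ⟨1 / D k, hpos, fun s hs => ?_⟩
    have hδk : δ k ≤ ε / 2 ^ k := by
      refine (min_le_right _ _).trans ?_
      gcongr
      linarith
    have hmid : dist (g k ⌊s * (D k : ℝ)⌋₊) (g k ⌊t * (D k : ℝ)⌋₊) < δ k := by
      rw [Real.dist_eq, abs_lt] at hs
      rcases le_total s t with h | h
      · exact hfloor k s t h (by linarith)
      · rw [dist_comm]; exact hfloor k t s h (by linarith)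
    calc dist (γ s) (γ t) ≤ dist (γ s) (g k ⌊s * (D k : ℝ)⌋₊) +
          dist (g k ⌊s * (D k : ℝ)⌋₊) (g k ⌊t * (D k : ℝ)⌋₊) +
          dist (g k ⌊t * (D k : ℝ)⌋₊) (γ t) := dist_triangle4 _ _ _ _
      _ ≤ ε / 2 ^ k + ε / 2 ^ k + ε / 2 ^ k := by
          gcongr
          · rw [dist_comm]; exact hγd s k
          · exact hmid.le.trans hδk
          · exact hγd t k
      _ = 3 * ε / 2 ^ k := by ring
      _ < η := hk
  refine ⟨⟨⟨fun t => γ t, hcont.comp continuous_subtype_val⟩, by simpa using hγ0,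
    by simpa using hγ1⟩, fun t => ?_⟩
  show dist (γ t) x ≤ ε
  rcases t.2.2.lt_or_eq with ht | ht
  · have := hγd t 0
    have e : ⌊(t : ℝ) * D 0⌋₊ = 0 := by
      rw [Nat.floor_eq_zero]; simpa [hD0] using ht
    rw [e, hg0] at this
    simpa [dist_comm] using this
  · rw [ht, hγ1, dist_comm]
    have : δ 0 ≤ ε / 2 / 2 ^ 0 := min_le_right _ _
    norm_num at this
    linarith
end Peano

/-! ### Rays converging to Peano continua -/

section Peano
variable {X : Type*} [MetricSpace X]

theorem DenseFreeInterval.IsLocallyConnectedContinuum.exists_uniform_small_path {L : Set X}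
    (hL : IsLocallyConnectedContinuum L) {ε : ℝ} (hε : 0 < ε) :
    ∃ δ > 0, ∀ x ∈ L, ∀ y ∈ L, dist x y < δ → ∃ γ : ℝ → X, Continuous γ ∧ (∀ t, γ t ∈ L) ∧
      γ 0 = x ∧ γ 1 = y ∧ ∀ t, dist (γ t) x ≤ ε := by
  have := isCompact_iff_compactSpace.1 hL.1
  have := hL.2.2
  obtain ⟨δ, hδ, h⟩ := _root_.exists_uniform_small_path (K := L) hε
  refine ⟨δ, hδ, fun x hx y hy hxy => ?_⟩
  obtain ⟨γ, hγ⟩ := h ⟨x, hx⟩ ⟨y, hy⟩ hxy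
  exact ⟨fun t => γ.extend t, by fun_prop, fun t => (γ.extend t).2, by simp, by simp,
    fun t => hγ _⟩

theorem DenseFreeInterval.IsLocallyConnectedContinuum.isPathConnected {L : Set X}
    (hL : IsLocallyConnectedContinuum L) : IsPathConnected L := by
  have := isCompact_iff_compactSpace.1 hL.1
  have := hL.2.2
  have := isConnected_iff_connectedSpace.1 hL.2.1
  rw [isPathConnected_iff_pathConnectedSpace]
  obtain ⟨δ, hδ, h⟩ := _root_.exists_uniform_small_path (K := L) one_pos
  refine ⟨inferInstance, fun x y => ?_⟩
  refine isPreconnected_univ.induction₂ Joined (fun x _ => ?_)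
    (fun _ _ _ _ _ _ => Joined.trans) (fun _ _ _ _ => Joined.symm) (mem_univ x) (mem_univ y)
  filter_upwards [mem_nhdsWithin_of_mem_nhds (Metric.ball_mem_nhds x hδ)] with y hy
  obtain ⟨γ, -⟩ := h x y (by rwa [dist_comm])
  exact ⟨γ⟩

/-- A path that stays near `L` can be approximated by a path in `L`, with prescribed ends. -/
theorem DenseFreeInterval.IsLocallyConnectedContinuum.exists_path_near {L : Set X}
    (hL : IsLocallyConnectedContinuum L) {ε : ℝ} (hε : 0 < ε) :
    ∃ η > 0, ∀ (u : ℝ → X) (a b : ℝ), a < b → ContinuousOn u (Icc a b) →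
      (∀ t ∈ Icc a b, Metric.infDist (u t) L < η) →
      ∀ x ∈ L, ∀ y ∈ L, dist x (u a) < η → dist y (u b) < η →
        ∃ h : ℝ → X, Continuous h ∧ (∀ t, h t ∈ L) ∧ h a = x ∧ h b = y ∧
          ∀ t ∈ Icc a b, dist (h t) (u t) ≤ ε := by
  obtain ⟨δ, hδ, hpath⟩ := hL.exists_uniform_small_path (half_pos hε)
  refine ⟨min (δ / 4) (ε / 4), by positivity, fun u a b hab hu hnear x hx y hy hxa hyb => ?_⟩
  set η := min (δ / 4) (ε / 4) with hη
  have hη0 : 0 < η := by positivity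
  have hη1 : η ≤ δ / 4 := min_le_left _ _
  have hη2 : η ≤ ε / 4 := min_le_right _ _
  obtain ⟨ρ, hρ, huc⟩ := Metric.uniformContinuousOn_iff.1
    (isCompact_Icc.uniformContinuousOn_of_continuous hu) η hη0
  obtain ⟨m, hm⟩ := exists_nat_gt ((b - a) / ρ)
  have hm0 : (0 : ℝ) < m := (div_pos (sub_pos.2 hab) hρ).trans hm
  set w := (b - a) / m with hw
  have hw0 : 0 < w := div_pos (sub_pos.2 hab) hm0
  have hwρ : w < ρ := by
    rw [hw, div_lt_iff₀ hm0, mul_comm]; rwa [div_lt_iff₀ hρ] at hm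
  have hmw : a + m * w = b := by rw [hw]; field_simp; ring
  -- one short step
  have hbase : ∀ c d, a ≤ c → c < d → d ≤ b → d ≤ c + w → ∀ x ∈ L, ∀ y ∈ L,
      dist x (u c) < η → dist y (u d) < η → ∃ h : ℝ → X, Continuous h ∧ (∀ t, h t ∈ L) ∧ h c = x ∧
        h d = y ∧ ∀ t ∈ Icc c d, dist (h t) (u t) ≤ ε := by
    intro c d hac hcd hdb hdw x hx y hy hxc hyd
    have hosc : ∀ t ∈ Icc c d, dist (u c) (u t) < η := by
      intro t ht
      refine huc c ⟨hac, hcd.le.trans hdb⟩ t ⟨hac.trans ht.1, ht.2.trans hdb⟩ ?_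
      rw [Real.dist_eq, abs_lt]
      constructor <;> linarith [ht.1, ht.2]
    obtain ⟨γ, hγ, hγL, h0, h1, hγd⟩ := hpath x hx y hy (by
      have := dist_triangle4 x (u c) (u d) y
      have := hosc d ⟨hcd.le, le_rfl⟩
      rw [dist_comm (u d) y] at *
      linarith)
    refine ⟨fun t => γ ((t - c) / (d - c)), by fun_prop, fun t => hγL _, by simpa using h0, ?_, ?_⟩
    · simp only [div_self (sub_pos.2 hcd).ne', h1]
    · intro t ht
      have h2 := dist_triangle4 (γ ((t - c) / (d - c))) x (u c) (u t)
      have h3 := hγd ((t - c) / (d - c))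
      have h4 := hosc t ht
      linarith
  have key : ∀ n : ℕ, a + (n + 1) * w ≤ b → ∀ y ∈ L, dist y (u (a + (n + 1) * w)) < η →
      ∃ h : ℝ → X, Continuous h ∧ (∀ t, h t ∈ L) ∧ h a = x ∧ h (a + (n + 1) * w) = y ∧
        ∀ t ∈ Icc a (a + (n + 1) * w), dist (h t) (u t) ≤ ε := by
    intro n
    induction n with
    | zero =>
      intro hb y hy hyd
      exact hbase a _ le_rfl (by simpa using hw0) hb (by simp) x hx y hy hxa hyd
    | succ n ih =>
      intro hb y hy hyd
      push_cast at hb hyd ⊢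
      have hc : a + ((n : ℝ) + 1) * w < a + ((n : ℝ) + 1 + 1) * w := by nlinarith
      have hac : a ≤ a + ((n : ℝ) + 1) * w := by
        have : (0 : ℝ) ≤ ((n : ℝ) + 1) * w := by positivity
        linarith
      obtain ⟨z, hz, hzd⟩ := (Metric.infDist_lt_iff ⟨x, hx⟩).1 (hnear _ ⟨hac, (hc.trans_le hb).le⟩)
      rw [dist_comm] at hzd
      obtain ⟨h₁, hc₁, hL₁, ha₁, hb₁, hd₁⟩ := ih (hc.le.trans hb) z hz hzd
      obtain ⟨h₂, hc₂, hL₂, ha₂, hb₂, hd₂⟩ := hbase _ _ hac hc hb (by linarith) z hz y hy hzd hyd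
      refine ⟨fun t => if t ≤ a + ((n : ℝ) + 1) * w then h₁ t else h₂ t,
        Continuous.if_le hc₁ hc₂ continuous_id continuous_const ?_, ?_, ?_, ?_, ?_⟩
      · rintro t rfl; rw [hb₁, ha₂]
      · intro t; dsimp only; split_ifs; exacts [hL₁ t, hL₂ t]
      · simp only [if_pos hac, ha₁]
      · simp only [if_neg hc.not_ge, hb₂]
      · intro t ht
        dsimp only
        split_ifs with h
        · exact hd₁ t ⟨ht.1, h⟩
        · exact hd₂ t ⟨(not_le.1 h).le, ht.2⟩
  obtain ⟨n, rfl⟩ : ∃ n, m = n + 1 :=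
    Nat.exists_eq_add_one_of_ne_zero (by rintro rfl; simp at hm0)
  push_cast at hmw
  have := key n hmw.le y hy (by rwa [hmw])
  rwa [hmw] at this

theorem continuous_glue_floor {Y : Type*} [TopologicalSpace Y] {h : ℕ → ℝ → Y}
    (hc : ∀ n, Continuous (h n)) (hm : ∀ n : ℕ, h n (n + 1) = h (n + 1) (n + 1)) :
    Continuous fun t : ℝ => h ⌊t⌋₊ t := by
  have key : ∀ n : ℕ, ContinuousOn (fun t : ℝ => h ⌊t⌋₊ t) (Iic (n : ℝ)) := by
    intro n
    induction n with
    | zero =>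
      refine (hc 0).continuousOn.congr fun t ht => ?_
      have ht : t ≤ 0 := by simpa using ht
      simp only [Nat.floor_of_nonpos ht]
    | succ n ih =>
      have : Iic ((n + 1 : ℕ) : ℝ) = Iic (n : ℝ) ∪ Icc (n : ℝ) (n + 1) := by
        rw [Iic_union_Icc_eq_Iic (by simp)]; push_cast; rfl
      rw [this]
      refine ih.union_of_isClosed ((hc n).continuousOn.congr fun t ht => ?_) isClosed_Iic
        isClosed_Icc
      rcases ht.2.lt_or_eq with h1 | h1
      · simp only [(Nat.floor_eq_iff ((Nat.cast_nonneg n).trans ht.1)).2 ⟨ht.1, h1⟩]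
      · have : ⌊(n : ℝ) + 1⌋₊ = n + 1 := by exact_mod_cast Nat.floor_natCast (R := ℝ) (n + 1)
        simp only [h1, this, hm]
  rw [continuous_iff_continuousAt]
  intro t
  obtain ⟨n, hn⟩ := exists_nat_gt t
  exact (key n).continuousAt (Iic_mem_nhds hn)

/-- A ray that converges to a locally connected continuum `L` is asymptotic to a path in `L`. -/
theorem DenseFreeInterval.IsLocallyConnectedContinuum.exists_ray_near {L : Set X}
    (hL : IsLocallyConnectedContinuum L) {u : ℝ → X} (hu : Continuous u)
    (hlim : Tendsto (fun t => Metric.infDist (u t) L) atTop (𝓝 0)) :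
    ∃ h : ℝ → X, Continuous h ∧ (∀ t, h t ∈ L) ∧
      Tendsto (fun t => dist (h t) (u t)) atTop (𝓝 0) := by
  have hne := hL.2.1.nonempty
  choose ν hνL hν using fun n : ℕ => hL.1.exists_infDist_eq_dist hne (u n)
  -- `S n ε`: a path in `L` follows `u` on `[n, n + 1]` with error at most `ε`
  let S : ℕ → ℝ → Prop := fun n ε => ∃ h : ℝ → X, Continuous h ∧ (∀ t, h t ∈ L) ∧ h n = ν n ∧
    h (n + 1) = ν (n + 1) ∧ ∀ t ∈ Icc (n : ℝ) (n + 1), dist (h t) (u t) ≤ ε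
  have hSpos : ∀ n ε, S n ε → 0 ≤ ε := by
    rintro n ε ⟨h, -, -, -, -, hd⟩
    exact dist_nonneg.trans (hd n ⟨le_rfl, by simp⟩)
  have hSne : ∀ n, ∃ ε, S n ε := by
    intro n
    obtain ⟨γ, hγ⟩ := hL.isPathConnected.joinedIn _ (hνL n) _ (hνL (n + 1))
    have hc : Continuous fun t : ℝ => γ.extend (t - n) := by fun_prop
    obtain ⟨C, hC⟩ := (isCompact_Icc (a := (n : ℝ)) (b := n + 1)).bddAbove_image
      (hc.dist hu).continuousOn
    refine ⟨C, _, hc, fun t => hγ _, by simp, by simp, fun t ht => hC ⟨t, ht, rfl⟩⟩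
  have hSev : ∀ ε > 0, ∀ᶠ n in atTop, S n ε := by
    intro ε hε
    obtain ⟨η, hη, H⟩ := hL.exists_path_near hε
    obtain ⟨T, hT⟩ := eventually_atTop.1 (hlim.eventually_lt_const hη)
    filter_upwards [eventually_ge_atTop ⌈T⌉₊] with n hn
    have hn : T ≤ n := Nat.ceil_le.1 hn
    have h1 : dist (ν n) (u n) < η := by rw [dist_comm, ← hν]; exact hT _ hn
    have h2 : dist (ν (n + 1)) (u (n + 1)) < η := by
      have := hν (n + 1)
      push_cast at this
      rw [dist_comm, ← this]; exact hT _ (by linarith)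
    exact H u n (n + 1) (by simp) hu.continuousOn (fun t ht => hT _ (hn.trans ht.1)) _ (hνL n) _
      (hνL (n + 1)) h1 h2
  -- almost optimal errors `e n` tend to zero
  have hchoose : ∀ n : ℕ, ∃ ε, S n ε ∧ ε < sInf {ε | S n ε} + 1 / ((n : ℝ) + 1) := by
    intro n
    exact exists_lt_of_csInf_lt (hSne n) (lt_add_of_pos_right _ (by positivity))
  choose e heS he using hchoose
  have he0 : Tendsto e atTop (𝓝 0) := by
    rw [Metric.tendsto_atTop']
    intro ε hε
    have h1 := (tendsto_one_div_add_atTop_nhds_zero_nat (𝕜 := ℝ)).eventually_lt_const (half_pos hε)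
    obtain ⟨N, hN⟩ := eventually_atTop.1 ((hSev _ (half_pos hε)).and h1)
    refine ⟨N, fun n hn => ?_⟩
    obtain ⟨h2, h3⟩ := hN n hn.le
    have h4 : sInf {ε | S n ε} ≤ ε / 2 := csInf_le ⟨0, fun _ => hSpos n _⟩ h2
    rw [Real.dist_eq, sub_zero, abs_of_nonneg (hSpos n _ (heS n))]
    linarith [he n]
  choose h hc hhL h0 h1 hd using heS
  refine ⟨fun t => h ⌊t⌋₊ t, continuous_glue_floor hc fun n => ?_, fun t => hhL _ _, ?_⟩
  · rw [h1]
    have := h0 (n + 1)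
    push_cast at this
    exact this.symm
  · refine squeeze_zero' (Eventually.of_forall fun _ => dist_nonneg) ?_
      (he0.comp tendsto_nat_floor_atTop)
    filter_upwards [eventually_ge_atTop 0] with t ht
    exact hd _ _ ⟨Nat.floor_le ht, (Nat.lt_floor_add_one t).le⟩

/-- The asymptotic path of `exists_ray_near` can be started at a given point `y` of a path connected
set `T ⊇ L`, at the price of leaving `L` for `T` in the beginning. -/
theorem DenseFreeInterval.IsLocallyConnectedContinuum.exists_ray_near_of_isPathConnected
    {L : Set X} (hL : IsLocallyConnectedContinuum L) {u : ℝ → X} (hu : Continuous u)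
    (hlim : Tendsto (fun t => Metric.infDist (u t) L) atTop (𝓝 0)) {T : Set X}
    (hT : IsPathConnected T) (hLT : L ⊆ T) {y : X} (hy : y ∈ T) (c : ℝ) :
    ∃ h : ℝ → X, Continuous h ∧ (∀ t, h t ∈ T) ∧ (∀ t ≤ c, h t = y) ∧
      Tendsto (fun t => dist (h t) (u t)) atTop (𝓝 0) := by
  obtain ⟨h, hc, hhL, hd⟩ := hL.exists_ray_near hu hlim
  obtain ⟨γ, hγ⟩ := hT.joinedIn _ hy _ (hLT (hhL (c + 1)))
  refine ⟨fun t => if t ≤ c + 1 then γ.extend (t - c) else h t,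
    Continuous.if_le (by fun_prop) hc continuous_id continuous_const ?_, fun t => ?_,
    fun t ht => ?_, hd.congr' ?_⟩
  · rintro t rfl; simp
  · dsimp only; split_ifs
    exacts [hγ _, hLT (hhL t)]
  · simp only [if_pos (show t ≤ c + 1 by linarith), γ.extend_of_le_zero (show t - c ≤ 0 by linarith)]
  · filter_upwards [eventually_gt_atTop (c + 1)] with t ht
    rw [if_neg ht.not_ge]
end Peano

/-! ### Parametrization of the free interval -/

namespace DenseFreeInterval

section HalfLine

theorem image_neg_Iic {X : Type*} (φ : ℝ → X) (a : ℝ) :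
    (fun t => φ (-t)) '' Iic a = φ '' Ici (-a) := by
  rw [← image_image φ Neg.neg]; simp

theorem image_neg_Ici {X : Type*} (φ : ℝ → X) (a : ℝ) :
    (fun t => φ (-t)) '' Ici a = φ '' Iic (-a) := by
  rw [← image_image φ Neg.neg]; simp

theorem range_neg {X : Type*} (φ : ℝ → X) : range (fun t => φ (-t)) = range φ :=
  (Equiv.neg ℝ).surjective.range_comp φ

/-- A half-line is recognized among the closed noncompact intervals by an endpoint, a point whose
removal does not disconnect it. -/
theorem eq_Iic_or_eq_Ici_of_isPreconnected_diff {S : Set ℝ} (hc : IsClosed S)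
    (hS : IsPreconnected S) (hnc : ¬ IsCompact S) {s : ℝ} (hs : s ∈ S)
    (hd : IsPreconnected (S \ {s})) : S = Iic s ∨ S = Ici s := by
  have hS' := hS.ordConnected
  by_cases h1 : ∃ x ∈ S, x < s
  · have h2 : S ⊆ Iic s := by
      intro y hy
      by_contra h
      obtain ⟨x, hx, hxs⟩ := h1
      exact (hd.ordConnected.out ⟨hx, hxs.ne⟩ ⟨hy, (not_le.1 h).ne'⟩ ⟨hxs.le, (not_le.1 h).le⟩).2 rfl
    refine Or.inl (h2.antisymm fun y hy => ?_)
    by_contra hyS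
    refine hnc ((isCompact_Icc (a := y) (b := s)).of_isClosed_subset hc fun z hz => ⟨?_, h2 hz⟩)
    by_contra hzy
    exact hyS (hS'.out hz hs ⟨(not_le.1 hzy).le, hy⟩)
  · push Not at h1
    refine Or.inr (Subset.antisymm h1 fun y hy => ?_)
    by_contra hyS
    refine hnc ((isCompact_Icc (a := s) (b := y)).of_isClosed_subset hc fun z hz => ⟨h1 z hz, ?_⟩)
    by_contra hzy
    exact hyS (hS'.out hs hz ⟨hy, (not_le.1 hzy).le⟩)

end HalfLine

section Arc
variable {X : Type*} [TopologicalSpace X]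

theorem locallyConnectedSpace_Icc : LocallyConnectedSpace (Icc (0 : ℝ) 1) :=
  (isQuotientMap_projIcc (h := zero_le_one (α := ℝ))).isCoinducing.locallyConnectedSpace

namespace IsArc
variable {P : Set X}

theorem isCompact (hP : IsArc P) : IsCompact P := by
  obtain ⟨e⟩ := hP
  have := e.symm.compactSpace
  exact isCompact_iff_compactSpace.2 this

theorem isPathConnected (hP : IsArc P) : IsPathConnected P := by
  obtain ⟨e⟩ := hP
  rw [isPathConnected_iff_pathConnectedSpace]
  have : PathConnectedSpace (Icc (0 : ℝ) 1) :=
    isPathConnected_iff_pathConnectedSpace.1 ((convex_Icc 0 1).isPathConnected ⟨0, by simp⟩)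
  exact e.symm.surjective.pathConnectedSpace e.symm.continuous

theorem isLocallyConnectedContinuum (hP : IsArc P) : IsLocallyConnectedContinuum P := by
  refine ⟨hP.isCompact, hP.isPathConnected.isConnected, ?_⟩
  obtain ⟨e⟩ := hP
  have := locallyConnectedSpace_Icc
  exact e.locallyConnectedSpace

theorem exists_injOn (hP : IsArc P) : ∃ ψ : X → ℝ, ContinuousOn ψ P ∧ InjOn ψ P := by
  classical
  obtain ⟨e⟩ := hP
  have h : ∀ x : P, (fun x => if h : x ∈ P then (e ⟨x, h⟩ : ℝ) else 0) x = e x := by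
    rintro ⟨x, hx⟩; simp [hx]
  refine ⟨fun x => if h : x ∈ P then (e ⟨x, h⟩ : ℝ) else 0, ?_, ?_⟩
  · rw [continuousOn_iff_continuous_domRestrict]
    exact (continuous_subtype_val.comp e.continuous).congr fun x => (h x).symm
  · intro x hx y hy hxy
    rw [h ⟨x, hx⟩, h ⟨y, hy⟩] at hxy
    exact congrArg Subtype.val (e.injective (Subtype.ext hxy))

theorem nontrivial (hP : IsArc P) : P.Nontrivial := by
  obtain ⟨e⟩ := hP
  refine ⟨e.symm ⟨0, by simp⟩, (e.symm _).2, e.symm ⟨1, by simp⟩, (e.symm _).2, fun h => ?_⟩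
  have := e.symm.injective (Subtype.ext h)
  simp at this

theorem of_continuous_injective [T2Space X] {θ : Icc (0 : ℝ) 1 → X} (hθ : Continuous θ)
    (hinj : Function.Injective θ) (hr : range θ = P) : IsArc P := by
  subst hr
  exact ⟨(hθ.isClosedEmbedding hinj).isEmbedding.toHomeomorph.symm⟩

end IsArc
end Arc

section Line
variable {X : Type*} [TopologicalSpace X]

/-- `R` is the end of `φ` at `+∞`: `φ t` converges to the set `R`, and every point of `R` is a
cluster point of `φ t`, as `t → +∞`. -/
structure IsEnd (φ : ℝ → X) (R : Set X) : Prop where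
  eventually_mem : ∀ U, IsOpen U → R ⊆ U → ∀ᶠ t in atTop, φ t ∈ U
  frequently_mem : ∀ x ∈ R, ∀ U, IsOpen U → x ∈ U → ∃ᶠ t in atTop, φ t ∈ U

/-- A parametrization `φ` by `ℝ` of the dense free interval of `X`, with remainders `L` at `-∞` and
`R` at `+∞`. This is `IsDecomposition L (range φ) R` with an orientation chosen. -/
structure IsLine (φ : ℝ → X) (L R : Set X) : Prop where
  isOpenEmbedding : IsOpenEmbedding φ
  union_eq : L ∪ range φ ∪ R = univ
  dense : DenseRange φ
  left_continuum : IsLocallyConnectedContinuum L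
  right_continuum : IsLocallyConnectedContinuum R
  notMem_left : ∀ t, φ t ∉ L
  notMem_right : ∀ t, φ t ∉ R
  left_end : IsEnd (fun t => φ (-t)) L
  right_end : IsEnd φ R
  isClosed_left : ∀ a, IsClosed (L ∪ φ '' Iic a)
  isClosed_right : ∀ a, IsClosed (R ∪ φ '' Ici a)

theorem IsLine.symm {φ : ℝ → X} {L R : Set X} (h : IsLine φ L R) :
    IsLine (fun t => φ (-t)) R L where
  isOpenEmbedding := h.isOpenEmbedding.comp (Homeomorph.neg ℝ).isOpenEmbedding
  union_eq := by rw [range_neg, ← h.union_eq]; ac_rfl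
  dense := by rw [DenseRange, range_neg]; exact h.dense
  left_continuum := h.right_continuum
  right_continuum := h.left_continuum
  notMem_left t := h.notMem_right _
  notMem_right t := h.notMem_left _
  left_end := by simpa using h.right_end
  right_end := h.left_end
  isClosed_left a := by rw [image_neg_Iic]; exact h.isClosed_right _
  isClosed_right a := by rw [image_neg_Ici]; exact h.isClosed_left _

/-- If `R ∪ φ([a, ∞))` is a compactification of `φ([a, ∞))`, then `R` is the end of `φ`. -/
theorem isEnd_and_isClosed [CompactSpace X] [T2Space X] {φ : ℝ → X} (hφ : IsOpenEmbedding φ)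
    {R : Set X} (hn : ∀ t, φ t ∉ R) {a : ℝ} (hc : IsClosed (R ∪ φ '' Ici a))
    (hd : R ⊆ closure (φ '' Ici a)) : IsEnd φ R ∧ ∀ b, IsClosed (R ∪ φ '' Ici b) := by
  refine ⟨⟨fun U hU hRU => ?_, fun x hx U hU hxU => ?_⟩, fun b => ?_⟩
  · have hK : IsCompact ((R ∪ φ '' Ici a) \ U) := (hc.sdiff hU).isCompact
    have hsub : (R ∪ φ '' Ici a) \ U ⊆ range φ := by
      rintro x ⟨hx | ⟨t, -, rfl⟩, hxU⟩
      exacts [(hxU (hRU hx)).elim, mem_range_self t]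
    obtain ⟨B, hB⟩ := ((hφ.isInducing.isCompact_preimage_iff hsub).2 hK).bddAbove
    filter_upwards [eventually_gt_atTop B, eventually_ge_atTop a] with t ht hta
    by_contra htU
    exact (hB (show t ∈ φ ⁻¹' _ from ⟨Or.inr ⟨t, hta, rfl⟩, htU⟩)).not_gt ht
  · rw [frequently_atTop]
    intro T
    have hK : IsClosed (φ '' Icc a T) := (isCompact_Icc.image hφ.continuous).isClosed
    have hxK : x ∉ φ '' Icc a T := by rintro ⟨t, -, rfl⟩; exact hn t hx
    obtain ⟨_, ⟨hyU, hyK⟩, t, ht, rfl⟩ := mem_closure_iff.1 (hd hx) (U ∩ (φ '' Icc a T)ᶜ)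
      (hU.inter hK.isOpen_compl) ⟨hxU, hxK⟩
    refine ⟨t, ?_, hyU⟩
    by_contra h
    exact hyK ⟨t, ⟨ht, (not_le.1 h).le⟩, rfl⟩
  · rcases le_total b a with hba | hab
    · rw [← Icc_union_Ici_eq_Ici hba, image_union, union_left_comm]
      exact (isCompact_Icc.image hφ.continuous).isClosed.union hc
    · have : R ∪ φ '' Ici b = (R ∪ φ '' Ici a) \ φ '' Iio b := by
        ext x
        constructor
        · rintro (hx | ⟨t, ht, rfl⟩)
          · refine ⟨Or.inl hx, ?_⟩
            rintro ⟨t, -, rfl⟩; exact hn t hx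
          · refine ⟨Or.inr ⟨t, hab.trans ht, rfl⟩, ?_⟩
            rintro ⟨s, hs, hst⟩
            rw [hφ.injective hst] at hs
            exact (mem_Ici.1 ht).not_gt hs
        · rintro ⟨hx | ⟨t, ht, rfl⟩, h⟩
          · exact Or.inl hx
          · refine Or.inr ⟨t, ?_, rfl⟩
            by_contra htb
            exact h ⟨t, mem_Iio.2 (not_le.1 htb), rfl⟩
      rw [this]
      exact hc.sdiff (hφ.isOpenMap _ isOpen_Iio)

theorem exists_isPreconnected_diff_of_isRay {S : Set X} (hS : IsRay S) :
    IsPreconnected S ∧ ¬ IsCompact S ∧ ∃ p ∈ S, IsPreconnected (S \ {p}) := by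
  obtain ⟨e⟩ := hS
  have himg : ∀ T : Set (Ici (0 : ℝ)), IsPreconnected (Subtype.val '' T) →
      IsPreconnected ((fun x => (e.symm x : X)) '' T) := by
    intro T hT
    refine ((IsInducing.subtypeVal.isPreconnected_image).1 hT).image _ ?_
    exact (continuous_subtype_val.comp e.symm.continuous).continuousOn
  have hS : (fun x => (e.symm x : X)) '' univ = S := by
    rw [image_univ]
    exact (e.symm.surjective.range_comp Subtype.val).trans Subtype.range_coe
  refine ⟨?_, fun hc => ?_, e.symm ⟨0, self_mem_Ici⟩, (e.symm _).2, ?_⟩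
  · rw [← hS]
    exact himg _ (by rw [image_univ, Subtype.range_coe]; exact isPreconnected_Ici)
  · have := isCompact_iff_compactSpace.1 hc
    have := isCompact_iff_compactSpace.2 e.compactSpace
    obtain ⟨B, hB⟩ := this.bddAbove
    have h1 : max 0 (B + 1) ≤ B := hB (show max 0 (B + 1) ∈ Ici (0 : ℝ) from mem_Ici.2 (le_max_left _ _))
    linarith [le_max_right 0 (B + 1)]
  · have : S \ {(e.symm ⟨0, self_mem_Ici⟩ : X)} = (fun x => (e.symm x : X)) '' {x | 0 < x.1} := by
      ext x
      constructor
      · rintro ⟨hx, hne⟩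
        refine ⟨e ⟨x, hx⟩, mem_ofPred.2 (lt_of_le_of_ne (mem_Ici.1 (e ⟨x, hx⟩).2) fun h => hne ?_), by simp⟩
        have : e ⟨x, hx⟩ = ⟨0, self_mem_Ici⟩ := Subtype.ext h.symm
        rw [← this]; simp
      · rintro ⟨y, hy, rfl⟩
        refine ⟨(e.symm y).2, fun h => ?_⟩
        have := e.symm.injective (Subtype.ext h)
        rw [this] at hy
        exact lt_irrefl _ (mem_ofPred.1 hy)
    rw [this]
    refine himg _ ?_
    have : Subtype.val '' {x : Ici (0 : ℝ) | 0 < x.1} = Ioi 0 := by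
      ext t
      constructor
      · rintro ⟨x, hx, rfl⟩; exact hx
      · intro ht; exact ⟨⟨t, mem_Ici.2 (le_of_lt ht)⟩, ht, rfl⟩
    rw [this]; exact isPreconnected_Ioi

/-- A ray in the line with compactifying remainder off the line is a closed half-line. -/
theorem exists_eq_image_Iic_or_Ici [CompactSpace X] [T2Space X] {φ : ℝ → X} (hφ : IsOpenEmbedding φ)
    {R S : Set X} (hn : ∀ t, φ t ∉ R) (hS : IsRay S) (hSφ : S ⊆ range φ)
    (hc : IsCompact (R ∪ S)) : ∃ a, S = φ '' Iic a ∨ S = φ '' Ici a := by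
  obtain ⟨h1, h2, p, hp, h3⟩ := exists_isPreconnected_diff_of_isRay hS
  obtain ⟨s, rfl⟩ := hSφ hp
  have himg : φ '' (φ ⁻¹' S) = S := by rw [image_preimage_eq_inter_range, inter_eq_left.2 hSφ]
  have hpre : φ ⁻¹' S = φ ⁻¹' (R ∪ S) := by
    ext t; simp [hn t]
  have key := eq_Iic_or_eq_Ici_of_isPreconnected_diff (S := φ ⁻¹' S) (s := s)
    (by rw [hpre]; exact hc.isClosed.preimage hφ.continuous)
    (hφ.isInducing.isPreconnected_image.1 (by rwa [himg]))
    (fun h => h2 (by rw [← himg]; exact h.image hφ.continuous)) hp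
    (hφ.isInducing.isPreconnected_image.1 (by
      rwa [image_sdiff hφ.injective, himg, image_singleton]))
  refine ⟨s, key.imp (fun h => ?_) (fun h => ?_)⟩ <;> rw [← h, himg]

theorem IsDecomposition.exists_isLine [CompactSpace X] [T2Space X] {L J R : Set X}
    (hX : IsDecomposition L J R) : ∃ φ : ℝ → X, IsLine φ L R ∧ range φ = J := by
  obtain ⟨hJo, ⟨e⟩⟩ := hX.freeInterval
  have hne : Nonempty (ℝ ≃ₜ Ioo (0 : ℝ) 1) := by
    have h1 : IsEmbedding fun t : ℝ => (unitInterval.sigmoid t : ℝ) :=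
      IsEmbedding.subtypeVal.comp isEmbedding_sigmoid
    have h2 : range (fun t : ℝ => (unitInterval.sigmoid t : ℝ)) = Ioo 0 1 := Real.range_sigmoid
    exact ⟨h1.toHomeomorph.trans (Homeomorph.setCongr h2)⟩
  obtain ⟨σ⟩ := hne
  let φ : ℝ → X := fun t => e.symm (σ t)
  have hφ : IsOpenEmbedding φ := hJo.isOpenEmbedding_subtypeVal.comp
    (σ.trans e.symm).isOpenEmbedding
  have hr : range φ = J := by
    rw [← Subtype.range_coe (s := J)]
    exact (σ.trans e.symm).surjective.range_comp Subtype.val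
  have hnL : ∀ t, φ t ∉ L := fun t h => hX.disjoint_left.ne_of_mem h (hr ▸ mem_range_self t) rfl
  have hnR : ∀ t, φ t ∉ R := fun t h => hX.disjoint_right.ne_of_mem h (hr ▸ mem_range_self t) rfl
  obtain ⟨JL, JR, hJL, hJR, hJ, ⟨hcL, -, hdL⟩, hcR, -, hdR⟩ := hX.exists_rays
  -- once the two rays are known to be at the expected ends, everything follows
  have main : ∀ (φ : ℝ → X) (a b : ℝ), IsOpenEmbedding φ → range φ = J → (∀ t, φ t ∉ L) →
      (∀ t, φ t ∉ R) → JL = φ '' Iic a → JR = φ '' Ici b → IsLine φ L R := by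
    intro φ a b hφ hr hnL hnR ha hb
    have h1 := isEnd_and_isClosed (hφ.comp (Homeomorph.neg ℝ).isOpenEmbedding)
      (fun t => hnL _) (a := -a)
      (by
        have := image_neg_Ici φ (-a)
        rw [neg_neg] at this
        show IsClosed (L ∪ (fun t => φ (-t)) '' _)
        rw [this, ← ha]; exact hcL.isClosed)
      (by
        have := image_neg_Ici φ (-a)
        rw [neg_neg] at this
        show L ⊆ closure ((fun t => φ (-t)) '' _)
        rw [this, ← ha]; exact subset_union_left.trans hdL)
    have h2 := isEnd_and_isClosed hφ hnR (a := b)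
      (by rw [← hb]; exact hcR.isClosed) (by rw [← hb]; exact subset_union_left.trans hdR)
    refine ⟨hφ, by rw [hr]; exact hX.union_eq, by rw [DenseRange, hr]; exact hX.dense,
      hX.left_continuum, hX.right_continuum, hnL, hnR, h1.1, h2.1, fun c => ?_, h2.2⟩
    have := h1.2 (-c)
    have h3 := image_neg_Ici φ (-c)
    rw [neg_neg] at h3
    rw [← h3]; exact this
  obtain ⟨a, ha⟩ := exists_eq_image_Iic_or_Ici hφ hnL hJL (by rw [hr, hJ]; exact subset_union_left) hcL
  obtain ⟨b, hb⟩ := exists_eq_image_Iic_or_Ici hφ hnR hJR (by rw [hr, hJ]; exact subset_union_right) hcR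
  rcases ha with ha | ha <;> rcases hb with hb | hb
  -- two rays at the same end do not cover the line
  · exfalso
    have : φ (max a b + 1) ∈ JL ∪ JR := by rw [← hJ, ← hr]; exact mem_range_self _
    rw [ha, hb, ← image_union, hφ.injective.mem_set_image] at this
    rcases this with h | h
    · linarith [mem_Iic.1 h, le_max_left a b]
    · linarith [mem_Iic.1 h, le_max_right a b]
  · exact ⟨φ, main φ a b hφ hr hnL hnR ha hb, hr⟩
  · refine ⟨fun t => φ (-t), main _ (-a) (-b) (hφ.comp (Homeomorph.neg ℝ).isOpenEmbedding)
      ((range_neg φ).trans hr) (fun t => hnL _) (fun t => hnR _) ?_ ?_, (range_neg φ).trans hr⟩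
    · rw [image_neg_Iic, neg_neg, ha]
    · rw [image_neg_Ici, neg_neg, hb]
  · exfalso
    have : φ (min a b - 1) ∈ JL ∪ JR := by rw [← hJ, ← hr]; exact mem_range_self _
    rw [ha, hb, ← image_union, hφ.injective.mem_set_image] at this
    rcases this with h | h
    · linarith [mem_Ici.1 h, min_le_left a b]
    · linarith [mem_Ici.1 h, min_le_right a b]
end Line
end DenseFreeInterval

/-! ### Connected sets and locally connected continua in the line -/

namespace DenseFreeInterval
section Line
variable {X : Type*} [TopologicalSpace X] {φ : ℝ → X} {L R : Set X}

namespace IsLine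

theorem disjoint_left (h : IsLine φ L R) : Disjoint L (range φ) := by
  rw [Set.disjoint_left]
  rintro _ hx ⟨t, rfl⟩
  exact h.notMem_left t hx

theorem disjoint_right (h : IsLine φ L R) : Disjoint R (range φ) := by
  rw [Set.disjoint_left]
  rintro _ hx ⟨t, rfl⟩
  exact h.notMem_right t hx

theorem mem_cases (h : IsLine φ L R) (x : X) : x ∈ L ∨ x ∈ range φ ∨ x ∈ R := by
  have : x ∈ L ∪ range φ ∪ R := by rw [h.union_eq]; trivial
  rcases this with (h | h) | h
  exacts [Or.inl h, Or.inr (Or.inl h), Or.inr (Or.inr h)]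

theorem Ici_union_ssubset {r : X} (h : IsLine φ L {r}) (c : ℝ) :
    {r} ∪ φ '' Ici c ⊂ {r} ∪ range φ := by
  refine ⟨union_subset_union_right _ (image_subset_range _ _), fun hsub => ?_⟩
  rcases hsub (Or.inr (mem_range_self (c - 1))) with h1 | ⟨t, ht, htc⟩
  · exact h.notMem_right _ h1
  · rw [h.isOpenEmbedding.injective htc] at ht
    linarith [mem_Ici.1 ht]

theorem eventually_notMem [T2Space X] (h : IsLine φ L R) {K : Set X} (hK : IsCompact K)
    (hd : Disjoint K R) : ∃ c, ∀ t ≥ c, φ t ∉ K :=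
  eventually_atTop.1 (h.right_end.eventually_mem Kᶜ hK.isClosed.isOpen_compl
    fun _ hx hxK => hd.ne_of_mem hxK hx rfl)

/-- A connected set that meets an interval of the line but not its ends lies in the interval. -/
theorem subset_image_Ioo [T2Space X] (h : IsLine φ L R) {C : Set X} (hC : IsPreconnected C)
    {a b t : ℝ} (ht : t ∈ Ioo a b) (htC : φ t ∈ C) (ha : φ a ∉ C) (hb : φ b ∉ C) :
    C ⊆ φ '' Ioo a b := by
  have hc := h.isOpenEmbedding.continuous
  refine hC.subset_of_closure_inter_subset (h.isOpenEmbedding.isOpenMap _ isOpen_Ioo)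
    ⟨_, htC, t, ht, rfl⟩ ?_
  rintro x ⟨hx, hxC⟩
  obtain ⟨s, hs, rfl⟩ := closure_minimal (image_mono Ioo_subset_Icc_self)
    (isCompact_Icc.image hc).isClosed hx
  refine ⟨s, ⟨lt_of_le_of_ne hs.1 ?_, lt_of_le_of_ne hs.2 ?_⟩, rfl⟩
  · rintro rfl; exact ha hxC
  · rintro rfl; exact hb hxC

/-- A connected set that avoids the line near both ends does not leave the line. -/
theorem subset_range_or_disjoint [T2Space X] (h : IsLine φ L R) {C : Set X}
    (hC : IsPreconnected C) {a b : ℝ} (ha : ∀ t ≤ a, φ t ∉ C) (hb : ∀ t ≥ b, φ t ∉ C) :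
    C ⊆ range φ ∨ Disjoint C (range φ) := by
  rw [or_iff_not_imp_right, Set.not_disjoint_iff]
  rintro ⟨_, htC, t, rfl⟩
  have h1 : a < t := not_le.1 fun h => ha t h htC
  have h2 : t < b := not_le.1 fun h => hb t h htC
  exact (h.subset_image_Ioo hC ⟨h1, h2⟩ htC (ha a le_rfl) (hb b le_rfl)).trans
    (image_subset_range _ _)

theorem compl_image_Iio (h : IsLine φ L R) (hd : Disjoint L R) (a : ℝ) :
    (L ∪ φ '' Iio a)ᶜ = R ∪ φ '' Ici a := by
  ext x
  constructor
  · intro hx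
    rcases h.mem_cases x with hxL | ⟨t, rfl⟩ | hxR
    · exact (hx (Or.inl hxL)).elim
    · refine Or.inr ⟨t, mem_Ici.2 (not_lt.1 fun ht => hx (Or.inr ⟨t, ht, rfl⟩)), rfl⟩
    · exact Or.inl hxR
  · rintro (hxR | ⟨t, ht, rfl⟩) (hxL | ⟨s, hs, hst⟩)
    · exact hd.ne_of_mem hxL hxR rfl
    · exact h.notMem_right s (hst ▸ hxR)
    · exact h.notMem_left t hxL
    · rw [h.isOpenEmbedding.injective hst] at hs
      exact (mem_Ici.1 ht).not_gt hs

theorem isOpen_left_union (h : IsLine φ L R) (hd : Disjoint L R) (a : ℝ) :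
    IsOpen (L ∪ φ '' Iio a) := by
  rw [← isClosed_compl_iff, h.compl_image_Iio hd]
  exact h.isClosed_right a

/-- When the ends are disjoint, a connected set that avoids the line near the end `L` cannot pass
from `L` to the rest of the space. -/
theorem subset_left_or_right (h : IsLine φ L R) (hd : Disjoint L R) {C : Set X}
    (hC : IsPreconnected C) {a : ℝ} (ha : ∀ t ≤ a, φ t ∉ C) :
    C ⊆ L ∨ C ⊆ range φ ∪ R := by
  have hsub : closure (L ∪ φ '' Iio a) ⊆ L ∪ φ '' Iic a :=
    closure_minimal (union_subset_union_right _ (image_mono Iio_subset_Iic_self))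
      (h.isClosed_left a)
  rw [or_iff_not_imp_right, Set.not_subset]
  rintro ⟨x, hxC, hx⟩
  have hxL : x ∈ L := by
    rcases h.mem_cases x with h1 | h1 | h1
    exacts [h1, (hx (Or.inl h1)).elim, (hx (Or.inr h1)).elim]
  have key : C ⊆ L ∪ φ '' Iio a := by
    refine hC.subset_of_closure_inter_subset (h.isOpen_left_union hd a) ⟨x, hxC, Or.inl hxL⟩ ?_
    rintro y ⟨hy, hyC⟩
    rcases hsub hy with hyL | ⟨t, ht, rfl⟩
    · exact Or.inl hyL
    · exact (ha t ht hyC).elim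
  intro y hy
  rcases key hy with hyL | ⟨t, ht, rfl⟩
  · exact hyL
  · exact (ha t (le_of_lt (mem_Iio.1 ht)) hy).elim

/-- A continuous image of a compact locally connected space cannot accumulate at a nondegenerate
end from within the line. Otherwise, near a cluster point of the parameters, a small connected set
would have an image that contains points of the line far out, but avoids a neighbourhood of some point
of `R`; the line enters this neighbourhood on both sides of those points, so the image would be
trapped in the line, contrary to the fact that its limit lies in `R`. -/
theorem exists_notMem_range [T2Space X] (h : IsLine φ L R) (hR : R.Nontrivial) {K : Type*}
    [TopologicalSpace K] [CompactSpace K] [LocallyConnectedSpace K] {g : K → X}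
    (hg : Continuous g) : ∃ c, ∀ t ≥ c, φ t ∉ range g := by
  by_contra! hcon
  choose t htn s hs using fun n : ℕ => hcon n
  -- a cluster point of the points `s n`; its image lies in `R`
  obtain ⟨z, hz⟩ := exists_clusterPt_of_compactSpace (map s atTop)
  have hz' : ∀ W ∈ 𝓝 z, ∀ n : ℕ, ∃ m ≥ n, s m ∈ W := fun W hW n =>
    (frequently_atTop.1 ((mapClusterPt_iff_frequently.1 hz) W hW)) n
  have hgz : g z ∈ R := by
    by_contra hgz
    obtain ⟨U, V, hU, hV, hRU, hzV, hUV⟩ :=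
      h.right_continuum.1.separation_of_notMem hgz
    obtain ⟨T, hT⟩ := eventually_atTop.1 (h.right_end.eventually_mem U hU hRU)
    obtain ⟨n, hn⟩ := exists_nat_ge T
    obtain ⟨m, hm, hmV⟩ := hz' _ ((hV.preimage hg).mem_nhds hzV) n
    have h1 : T ≤ t m := hn.trans ((Nat.cast_le.2 hm).trans (htn m))
    exact hUV.ne_of_mem (hT _ h1) (show φ (t m) ∈ V by rw [← hs]; exact hmV) rfl
  -- the line enters a neighbourhood `V` of `y` at parameters `a < t m < b`
  obtain ⟨y, hyR, hyz⟩ := hR.exists_ne (g z)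
  obtain ⟨U, V, hU, hV, hzU, hyV, hUV⟩ := t2_separation hyz.symm
  obtain ⟨W, ⟨hWo, hzW, hW⟩, hWU⟩ := (LocallyConnectedSpace.open_connected_basis z).mem_iff.1
    ((hU.preimage hg).mem_nhds hzU)
  have hfreq := frequently_atTop.1 (h.right_end.frequently_mem y hyR V hV hyV)
  obtain ⟨a, -, ha⟩ := hfreq 0
  obtain ⟨n, hn⟩ := exists_nat_gt a
  obtain ⟨m, hm, hmW⟩ := hz' W (hWo.mem_nhds hzW) n
  have hat : a < t m := hn.trans_le ((Nat.cast_le.2 hm).trans (htn m))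
  obtain ⟨b, hb, hbV⟩ := hfreq (t m + 1)
  have hgW : ∀ r, φ r ∈ V → φ r ∉ g '' W := by
    rintro r hr ⟨w, hw, hwr⟩
    exact hUV.ne_of_mem (hWU hw) (show g w ∈ V by rwa [hwr]) rfl
  have := h.subset_image_Ioo (hW.isPreconnected.image g hg.continuousOn) (t := t m)
    ⟨hat, by linarith⟩ ⟨s m, hmW, hs m⟩ (hgW a ha) (hgW b hbV)
  obtain ⟨r, -, hr⟩ := this ⟨z, hzW, rfl⟩
  exact h.notMem_right r (hr ▸ hgz)

theorem exists_notMem_image [T2Space X] (h : IsLine φ L R) (hR : R.Nontrivial) {K : Set X}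
    (hK : IsLocallyConnectedContinuum K) {f : X → X} (hf : Continuous f) :
    ∃ c, ∀ t ≥ c, φ t ∉ f '' K := by
  have := isCompact_iff_compactSpace.1 hK.1
  have := hK.2.2
  have := h.exists_notMem_range hR (hf.comp (continuous_subtype_val (p := (· ∈ K))))
  rwa [range_comp, Subtype.range_coe] at this

theorem exists_notMem_image_left [T2Space X] (h : IsLine φ L R) (hL : L.Nontrivial) {K : Set X}
    (hK : IsLocallyConnectedContinuum K) {f : X → X} (hf : Continuous f) :
    ∃ c, ∀ t ≤ c, φ t ∉ f '' K := by
  obtain ⟨c, hc⟩ := h.symm.exists_notMem_image hL hK hf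
  exact ⟨-c, fun t ht => by simpa using hc (-t) (by linarith)⟩

theorem isArc_image_Icc [T2Space X] (h : IsLine φ L R) {a b : ℝ} (hab : a < b) :
    IsArc (φ '' Icc a b) := by
  have hba : 0 < b - a := sub_pos.2 hab
  refine IsArc.of_continuous_injective (θ := fun s => φ (a + s * (b - a)))
    (h.isOpenEmbedding.continuous.comp (by fun_prop)) (fun s t hst => ?_) ?_
  · have := h.isOpenEmbedding.injective hst
    exact Subtype.ext (mul_right_cancel₀ hba.ne' (add_left_cancel this))
  · ext x
    constructor
    · rintro ⟨s, rfl⟩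
      refine ⟨_, ⟨?_, ?_⟩, rfl⟩
      · nlinarith [s.2.1]
      · nlinarith [s.2.2]
    · rintro ⟨t, ht, rfl⟩
      refine ⟨⟨(t - a) / (b - a), ⟨div_nonneg (sub_nonneg.2 ht.1) hba.le, ?_⟩⟩, ?_⟩
      · rw [div_le_one hba]; linarith [ht.2]
      · dsimp only
        rw [div_mul_cancel₀ _ hba.ne', add_sub_cancel]

theorem isArc_Ici_union [T2Space X] {r : X} (h : IsLine φ L {r}) (c : ℝ) :
    IsArc ({r} ∪ φ '' Ici c) := by
  let θ : Icc (0 : ℝ) 1 → X := fun s => if s.1 < 1 then φ (c + s / (1 - s)) else r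
  have hlt : ∀ s : Icc (0 : ℝ) 1, s.1 < 1 → θ s = φ (c + s / (1 - s)) := fun s hs => if_pos hs
  have hone : ∀ s : Icc (0 : ℝ) 1, ¬ s.1 < 1 → θ s = r := fun s hs => if_neg hs
  have hr : ∀ t, φ t ≠ r := fun t ht => h.notMem_right t ht
  refine IsArc.of_continuous_injective (θ := θ) ?_ (fun s t hst => ?_) ?_
  · rw [continuous_iff_continuousAt]
    intro s
    by_cases hs : s.1 < 1
    · have h1 : θ =ᶠ[𝓝 s] fun s => φ (c + s / (1 - s)) := by
        filter_upwards [continuous_subtype_val.continuousAt.eventually_lt_const hs]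
          with x hx using hlt x hx
      refine ContinuousAt.congr ?_ h1.symm
      refine h.isOpenEmbedding.continuous.continuousAt.comp ?_
      have : (1 : ℝ) - s ≠ 0 := by linarith
      fun_prop (disch := assumption)
    · have hs1 : s.1 = 1 := le_antisymm s.2.2 (not_lt.1 hs)
      intro V hV
      rw [hone s hs] at hV
      obtain ⟨U, hUV, hU, hrU⟩ := mem_nhds_iff.1 hV
      obtain ⟨T, hT⟩ := eventually_atTop.1
        (h.right_end.eventually_mem U hU (singleton_subset_iff.2 hrU))
      have hcont : ContinuousAt (fun x : Icc (0 : ℝ) 1 => (T - c) * (1 - x.1) - x.1) s := by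
        fun_prop
      have hneg : (T - c) * (1 - s.1) - s.1 < 0 := by rw [hs1]; norm_num
      show ∀ᶠ x in 𝓝 s, θ x ∈ V
      filter_upwards [hcont.eventually_lt_const hneg] with x hx
      by_cases hx1 : x.1 < 1
      · rw [hlt x hx1]
        refine hUV (hT _ ?_)
        have : T - c ≤ x / (1 - x) := by rw [le_div_iff₀ (by linarith)]; linarith
        linarith
      · rw [hone x hx1]; exact hUV hrU
  · by_cases hs : s.1 < 1 <;> by_cases ht : t.1 < 1
    · rw [hlt s hs, hlt t ht] at hst
      have := add_left_cancel (h.isOpenEmbedding.injective hst)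
      rw [div_eq_div_iff (by linarith) (by linarith)] at this
      exact Subtype.ext (by linarith)
    · rw [hlt s hs, hone t ht] at hst; exact (hr _ hst).elim
    · rw [hone s hs, hlt t ht] at hst; exact (hr _ hst.symm).elim
    · exact Subtype.ext ((le_antisymm s.2.2 (not_lt.1 hs)).trans
        (le_antisymm t.2.2 (not_lt.1 ht)).symm)
  · ext x
    constructor
    · rintro ⟨s, rfl⟩
      by_cases hs : s.1 < 1
      · refine Or.inr ⟨_, ?_, (hlt s hs).symm⟩
        have : 0 ≤ s.1 / (1 - s.1) := div_nonneg s.2.1 (by linarith)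
        simpa using this
      · exact Or.inl (hone s hs)
    · rintro (hx | ⟨t, ht, rfl⟩)
      · exact ⟨⟨1, by simp⟩, (hone _ (by simp)).trans (mem_singleton_iff.1 hx).symm⟩
      · have ht : c ≤ t := ht
        have hpos : 0 < 1 + (t - c) := by linarith
        have hl : (t - c) / (1 + (t - c)) < 1 := by rw [div_lt_one hpos]; linarith
        refine ⟨⟨(t - c) / (1 + (t - c)), div_nonneg (by linarith) hpos.le, hl.le⟩, ?_⟩
        rw [hlt _ hl]
        congr 1
        dsimp only
        field_simp
        ring

end IsLine
end Line
end DenseFreeInterval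

/-! ### Retractions onto the ends -/

namespace DenseFreeInterval
section Retraction
variable {X : Type*}

theorem minimalSetsIn_subset_of_retract [TopologicalSpace X] [T2Space X] {A B : Set X}
    (hAB : A ⊆ B) {F : X → X} (hF : ContinuousOn F B) (hFA : MapsTo F B A)
    (hid : ∀ x ∈ A, F x = x) : minimalSetsIn A ⊆ minimalSetsIn B := by
  intro M hM
  obtain ⟨hMA, f, hf, hfA, hmin⟩ := mem_minimalSetsIn_iff.1 hM
  exact mem_minimalSetsIn_iff.2 ⟨hMA.trans hAB, f ∘ F, hf.comp hF hFA,
    fun x hx => hAB (hfA (hFA hx)), hmin.congr fun x hx => by simp [hid x (hMA hx)]⟩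

namespace IsLine
variable {φ : ℝ → X} {L R : Set X}

/-- A map given by `u` along the line and by `G` off the line is continuous if `u t` and `G (φ t)`
are asymptotic at both ends. -/
theorem exists_continuous_extension [MetricSpace X] (h : IsLine φ L R) {u : ℝ → X}
    (hu : Continuous u) {G : X → X} (hG : ∀ x ∉ range φ, ContinuousAt G x)
    (htop : Tendsto (fun t => dist (u t) (G (φ t))) atTop (𝓝 0))
    (hbot : Tendsto (fun t => dist (u t) (G (φ t))) atBot (𝓝 0)) :
    ∃ F : X → X, Continuous F ∧ (∀ t, F (φ t) = u t) ∧ ∀ x ∉ range φ, F x = G x := by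
  classical
  have hinj := h.isOpenEmbedding.injective
  let F : X → X := fun x => if x ∈ range φ then u (Function.invFun φ x) else G x
  have hFφ : ∀ t, F (φ t) = u t := fun t => by
    simp only [F, mem_range_self, if_true, Function.leftInverse_invFun hinj t]
  have hFG : ∀ x ∉ range φ, F x = G x := fun x hx => if_neg hx
  refine ⟨F, ?_, hFφ, hFG⟩
  rw [continuous_iff_continuousAt]
  intro x
  by_cases hx : x ∈ range φ
  · obtain ⟨t, rfl⟩ := hx
    rw [← h.isOpenEmbedding.continuousAt_iff]
    exact hu.continuousAt.congr (Eventually.of_forall fun t => (hFφ t).symm)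
  · rw [Metric.continuousAt_iff']
    intro ε hε
    obtain ⟨b, hb⟩ := eventually_atTop.1 (htop.eventually_lt_const (half_pos hε))
    obtain ⟨a, ha⟩ := eventually_atBot.1 (hbot.eventually_lt_const (half_pos hε))
    filter_upwards [Metric.continuousAt_iff'.1 (hG x hx) _ (half_pos hε),
      (isCompact_Icc.image h.isOpenEmbedding.continuous).isClosed.isOpen_compl.mem_nhds
        (fun ⟨t, _, ht⟩ => hx ⟨t, ht⟩ : x ∉ φ '' Icc a b)] with y hy hyK
    rw [hFG x hx]
    by_cases hyr : y ∈ range φ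
    · obtain ⟨t, rfl⟩ := hyr
      rw [hFφ]
      have h1 : dist (u t) (G (φ t)) < ε / 2 := by
        by_cases hta : t ≤ a
        · exact ha t hta
        · refine hb t ?_
          by_contra htb
          exact hyK ⟨t, ⟨(not_le.1 hta).le, (not_le.1 htb).le⟩, rfl⟩
      linarith [dist_triangle (u t) (G (φ t)) (G x)]
    · rw [hFG y hyr]; linarith

theorem tendsto_infDist [MetricSpace X] (h : IsLine φ L R) :
    Tendsto (fun t => Metric.infDist (φ t) R) atTop (𝓝 0) := by
  rw [Metric.tendsto_nhds]
  intro ε hε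
  filter_upwards [h.right_end.eventually_mem (Metric.thickening ε R) Metric.isOpen_thickening
    (Metric.self_subset_thickening hε R)] with t ht
  rw [Real.dist_eq, sub_zero, abs_of_nonneg Metric.infDist_nonneg]
  rw [Metric.mem_thickening_iff] at ht
  obtain ⟨z, hz, hd⟩ := ht
  exact (Metric.infDist_le_dist_of_mem hz).trans_lt hd

theorem exists_near_right [MetricSpace X] (h : IsLine φ L R) {T : Set X} (hT : IsPathConnected T)
    (hRT : R ⊆ T) {y : X} (hy : y ∈ T) (c : ℝ) :
    ∃ u : ℝ → X, Continuous u ∧ (∀ t, u t ∈ T) ∧ (∀ t ≤ c, u t = y) ∧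
      Tendsto (fun t => dist (u t) (φ t)) atTop (𝓝 0) :=
  h.right_continuum.exists_ray_near_of_isPathConnected h.isOpenEmbedding.continuous
    h.tendsto_infDist hT hRT hy c

theorem exists_near_left [MetricSpace X] (h : IsLine φ L R) {T : Set X} (hT : IsPathConnected T)
    (hLT : L ⊆ T) {y : X} (hy : y ∈ T) (c : ℝ) :
    ∃ u : ℝ → X, Continuous u ∧ (∀ t, u t ∈ T) ∧ (∀ t ≥ c, u t = y) ∧
      Tendsto (fun t => dist (u t) (φ t)) atBot (𝓝 0) := by
  obtain ⟨u, hu, huT, huy, hud⟩ := h.symm.exists_near_right hT hLT hy (-c)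
  refine ⟨fun t => u (-t), by fun_prop, fun t => huT _, fun t ht => huy _ (by linarith), ?_⟩
  simpa [Function.comp_def] using hud.comp tendsto_neg_atBot_atTop

variable [TopologicalSpace X] [TopologicalSpace.MetrizableSpace X]

/-- If the ends are disjoint, `L` is a retract of `X`: the line follows `L` near `L`, and is mapped to
a point, together with `R`, near `R`. -/
theorem exists_retraction_left (h : IsLine φ L R) (hd : Disjoint L R) :
    ∃ F : X → X, Continuous F ∧ (∀ x, F x ∈ L) ∧ ∀ x ∈ L, F x = x := by
  classical
  let := TopologicalSpace.metrizableSpaceMetric X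
  obtain ⟨y, hy⟩ := h.left_continuum.2.1.nonempty
  obtain ⟨u, hu, huL, huy, hud⟩ := h.exists_near_left h.left_continuum.isPathConnected
    Subset.rfl hy 0
  let G : X → X := fun x => if x ∈ L ∪ φ '' Iio 0 then x else y
  have hGpos : ∀ x ∈ L ∪ φ '' Iio 0, G x = x := fun x hx => if_pos hx
  have hGneg : ∀ x ∉ L ∪ φ '' Iio 0, G x = y := fun x hx => if_neg hx
  have hφ0 : ∀ t ≥ 0, φ t ∉ L ∪ φ '' Iio 0 := by
    rintro t ht (hL | ⟨s, hs, hst⟩)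
    · exact h.notMem_left t hL
    · rw [h.isOpenEmbedding.injective hst] at hs
      exact (mem_Iio.1 hs).not_ge ht
  have key := h.exists_continuous_extension hu (G := G) (fun x hx => ?_) ?_ ?_
  · obtain ⟨F, hF, hFφ, hFG⟩ := key
    have hL : ∀ x ∈ L, F x = x := fun x hx => by
      rw [hFG x (h.disjoint_left.notMem_of_mem_left hx), hGpos x (Or.inl hx)]
    refine ⟨F, hF, fun x => ?_, hL⟩
    rcases h.mem_cases x with hx | ⟨t, rfl⟩ | hx
    · rwa [hL x hx]
    · rw [hFφ]; exact huL t
    · rw [hFG x (h.disjoint_right.notMem_of_mem_left hx), hGneg]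
      · exact hy
      · rintro (hxL | ⟨s, -, rfl⟩)
        · exact hd.ne_of_mem hxL hx rfl
        · exact h.notMem_right s hx
  · rcases h.mem_cases x with hxL | hxφ | hxR
    · refine continuousAt_id.congr ?_
      filter_upwards [(h.isOpen_left_union hd 0).mem_nhds (Or.inl hxL)] with z hz
        using (hGpos z hz).symm
    · exact (hx hxφ).elim
    · refine (continuousAt_const (y := y)).congr ?_
      have hxn : x ∈ (L ∪ φ '' Iic 0)ᶜ := by
        rintro (hxL | ⟨s, -, rfl⟩)
        · exact hd.ne_of_mem hxL hxR rfl
        · exact h.notMem_right s hxR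
      filter_upwards [(h.isClosed_left 0).isOpen_compl.mem_nhds hxn] with z hz
      refine (hGneg z fun hz' => hz ?_).symm
      exact union_subset_union_right _ (image_mono Iio_subset_Iic_self) hz'
  · refine tendsto_const_nhds.congr' ?_
    filter_upwards [eventually_ge_atTop 0] with t ht
    rw [hGneg _ (hφ0 t ht), huy t ht, dist_self]
  · refine hud.congr' ?_
    filter_upwards [eventually_lt_atBot 0] with t ht
    rw [hGpos _ (Or.inr ⟨t, ht, rfl⟩)]

/-- If the ends intersect, `L ∪ R` is a retract of `X`. -/
theorem exists_retraction_union (h : IsLine φ L R) (hne : (L ∩ R).Nonempty) :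
    ∃ F : X → X, Continuous F ∧ (∀ x, F x ∈ L ∪ R) ∧ ∀ x ∈ L ∪ R, F x = x := by
  let := TopologicalSpace.metrizableSpaceMetric X
  obtain ⟨y, hyL, hyR⟩ := hne
  obtain ⟨u, hu, huL, huy, hud⟩ := h.exists_near_left h.left_continuum.isPathConnected
    Subset.rfl hyL 0
  obtain ⟨v, hv, hvR, hvy, hvd⟩ := h.exists_near_right h.right_continuum.isPathConnected
    Subset.rfl hyR 0
  let w : ℝ → X := fun t => if t ≤ 0 then u t else v t
  have hw : Continuous w := Continuous.if_le hu hv continuous_id continuous_const (by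
    rintro t rfl; rw [huy _ le_rfl, hvy _ le_rfl])
  have key := h.exists_continuous_extension hw (G := id)
    (fun x _ => continuousAt_id) ?_ ?_
  · obtain ⟨F, hF, hFφ, hFG⟩ := key
    have hid : ∀ x ∈ L ∪ R, F x = x := fun x hx => hFG x (by
      rcases hx with hx | hx
      exacts [h.disjoint_left.notMem_of_mem_left hx, h.disjoint_right.notMem_of_mem_left hx])
    refine ⟨F, hF, fun x => ?_, hid⟩
    rcases h.mem_cases x with hx | ⟨t, rfl⟩ | hx
    · rw [hid x (Or.inl hx)]; exact Or.inl hx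
    · rw [hFφ]
      by_cases ht : t ≤ 0
      · exact Or.inl (by simpa only [w, if_pos ht] using huL t)
      · exact Or.inr (by simpa only [w, if_neg ht] using hvR t)
    · rw [hid x (Or.inr hx)]; exact Or.inr hx
  · refine hvd.congr' ?_
    filter_upwards [eventually_gt_atTop 0] with t ht
    simp only [w, if_neg ht.not_ge, id]
  · refine hud.congr' ?_
    filter_upwards [eventually_le_atBot 0] with t ht
    simp only [w, if_pos ht, id]

/-- If the right end is a point of `L`, the union of `L` and a closed half-line is a retract of
`X`. -/
theorem exists_retraction_union_arc {r : X} (h : IsLine φ L {r}) (hr : r ∈ L) (c : ℝ) :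
    ∃ F : X → X, Continuous F ∧ (∀ x, F x ∈ L ∪ ({r} ∪ φ '' Ici c)) ∧
      ∀ x ∈ L ∪ ({r} ∪ φ '' Ici c), F x = x := by
  let := TopologicalSpace.metrizableSpaceMetric X
  have hT : IsPathConnected (L ∪ ({r} ∪ φ '' Ici c)) :=
    h.left_continuum.isPathConnected.union (h.isArc_Ici_union c).isPathConnected
      ⟨r, hr, Or.inl rfl⟩
  obtain ⟨u, hu, huT, huy, hud⟩ := h.exists_near_left hT subset_union_left
    (y := φ c) (Or.inr (Or.inr ⟨c, self_mem_Ici, rfl⟩)) c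
  let w : ℝ → X := fun t => if t ≤ c then u t else φ t
  have hw : Continuous w := Continuous.if_le hu h.isOpenEmbedding.continuous continuous_id
    continuous_const (by rintro t rfl; rw [huy _ le_rfl])
  have key := h.exists_continuous_extension hw (G := id)
    (fun x _ => continuousAt_id) ?_ ?_
  · obtain ⟨F, hF, hFφ, hFG⟩ := key
    have hid : ∀ x ∈ L ∪ ({r} ∪ φ '' Ici c), F x = x := by
      rintro x (hx | hx | ⟨t, ht, rfl⟩)
      · exact hFG x (h.disjoint_left.notMem_of_mem_left hx)
      · exact hFG x (h.disjoint_right.notMem_of_mem_left hx)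
      · rw [hFφ]
        by_cases htc : t ≤ c
        · have : t = c := le_antisymm htc ht
          subst this
          simp only [w, if_pos le_rfl, huy _ le_rfl]
        · simp only [w, if_neg htc]
    refine ⟨F, hF, fun x => ?_, hid⟩
    rcases h.mem_cases x with hx | ⟨t, rfl⟩ | hx
    · rw [hid x (Or.inl hx)]; exact Or.inl hx
    · rw [hFφ]
      by_cases ht : t ≤ c
      · simpa only [w, if_pos ht] using huT t
      · simp only [w, if_neg ht]
        exact Or.inr (Or.inr ⟨t, (not_le.1 ht).le, rfl⟩)
    · rw [hid x (Or.inr (Or.inl hx))]; exact Or.inr (Or.inl hx)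
  · refine tendsto_const_nhds.congr' ?_
    filter_upwards [eventually_gt_atTop c] with t ht
    simp only [w, if_neg ht.not_ge, id, dist_self]
  · refine hud.congr' ?_
    filter_upwards [eventually_le_atBot c] with t ht
    simp only [w, if_pos ht, id]

end IsLine
end Retraction
end DenseFreeInterval

/-! ### Subspaces exhausted by arcs, and transfer of minimal sets -/

namespace DenseFreeInterval
section ArcExhausted
variable {X : Type*} [TopologicalSpace X] [TopologicalSpace.MetrizableSpace X] {B : Set X}

/-- Every compact subset of `B` lies in an arc in `B`. -/
def IsArcExhausted (B : Set X) : Prop :=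
  ∀ M, IsCompact M → M ⊆ B → ∃ P, IsArc P ∧ M ⊆ P ∧ P ⊆ B

theorem IsArcExhausted.mem_finiteOrCantorSubsets (hB : IsArcExhausted B) {f : X → X} {M : Set X}
    (hM : IsMinimalSetOf f M) (hf : ContinuousOn f M) (hMB : M ⊆ B) :
    M ∈ finiteOrCantorSubsets B := by
  obtain ⟨P, hP, hMP, -⟩ := hB M hM.2.1 hMB
  obtain ⟨ψ, hψ, hinj⟩ := hP.exists_injOn
  exact ⟨hMB, (hM.finite_or_isCantorSet hf (hψ.mono hMP) (hinj.mono hMP)).imp_left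
    fun h => ⟨hM.1, h⟩⟩

theorem IsArcExhausted.mem_minimalSetsIn (hB : IsArcExhausted B) {M A : Set X}
    (hM : M ∈ finiteOrCantorSubsets B) (hBA : B ⊆ A) : M ∈ minimalSetsIn A := by
  obtain ⟨hMB, hM⟩ := hM
  obtain ⟨P, hP, hMP, hPB⟩ := hB M (hM.elim (fun h => h.2.isCompact) fun h => h.2.1) hMB
  exact mem_minimalSetsIn_of_subset_arc hM hP hMP (hPB.trans hBA)

theorem IsArcExhausted.minimalSetsIn_eq (hB : IsArcExhausted B) :
    minimalSetsIn B = finiteOrCantorSubsets B := by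
  refine Subset.antisymm (fun M hM => ?_) fun M hM => hB.mem_minimalSetsIn hM Subset.rfl
  obtain ⟨hMB, f, hf, -, hmin⟩ := mem_minimalSetsIn_iff.1 hM
  exact hB.mem_finiteOrCantorSubsets hmin (hf.mono hMB) hMB

theorem IsArcExhausted.mem_minimalSetsIn_of_isMinimalSetOf (hB : IsArcExhausted B) {f : X → X}
    {M : Set X} (hM : IsMinimalSetOf f M) (hf : Continuous f) (hMB : M ⊆ B) :
    M ∈ minimalSetsIn B :=
  hB.mem_minimalSetsIn (hB.mem_finiteOrCantorSubsets hM hf.continuousOn hMB) Subset.rfl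

theorem IsArcExhausted.minimalSetsIn_subset_minimalSets (hB : IsArcExhausted B) :
    minimalSetsIn B ⊆ minimalSets X := by
  rw [← minimalSetsIn_univ, hB.minimalSetsIn_eq]
  exact fun M hM => hB.mem_minimalSetsIn hM (subset_univ _)

end ArcExhausted

section MinimalSets
variable {X : Type*} [TopologicalSpace X]

theorem disjoint_minimalSetsIn [T2Space X] {A B : Set X} (h : Disjoint A B) :
    Disjoint (minimalSetsIn A) (minimalSetsIn B) := by
  rw [Set.disjoint_left]
  intro M hA hB
  obtain ⟨h1, f, -, -, hM⟩ := mem_minimalSetsIn_iff.1 hA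
  obtain ⟨x, hx⟩ := hM.1
  exact h.ne_of_mem (h1 hx) ((mem_minimalSetsIn_iff.1 hB).1 hx) rfl

theorem minimalSetsIn_subset_minimalSets_of_retract [T2Space X] {A : Set X} {F : X → X}
    (hF : Continuous F) (hFA : ∀ x, F x ∈ A) (hid : ∀ x ∈ A, F x = x) :
    minimalSetsIn A ⊆ minimalSets X := by
  rw [← minimalSetsIn_univ]
  exact minimalSetsIn_subset_of_retract (subset_univ _) hF.continuousOn (fun x _ => hFA x) hid

theorem IsMinimalSetOf.mem_minimalSetsIn [T2Space X] {f : X → X} {M A : Set X}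
    (hM : IsMinimalSetOf f M) (hf : Continuous f) (hMA : M ⊆ A) (hA : MapsTo f A A) :
    M ∈ minimalSetsIn A :=
  mem_minimalSetsIn_iff.2 ⟨hMA, f, hf.continuousOn, hA, hM⟩

theorem IsMinimalSetOf.exists_preimage {f : X → X} {M : Set X} (hM : IsMinimalSetOf f M) {x : X}
    (hx : x ∈ M) : ∃ y ∈ M, f y = x := by
  rw [← hM.2.2.1] at hx; exact hx

theorem IsMinimalSetOf.subset_or_disjoint [T2Space X] {f : X → X} {M K : Set X}
    (hM : IsMinimalSetOf f M) (hK : IsClosed K) (hf : MapsTo f K K) : M ⊆ K ∨ Disjoint M K := by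
  rw [or_iff_not_imp_right, Set.not_disjoint_iff]
  rintro ⟨x, hxM, hxK⟩
  exact hM.subset_of_mapsTo hK (hf.mono_left inter_subset_right) ⟨x, hxM, hxK⟩

/-- The line is dense, so a closed set that contains its image under `f` contains all values of
`f`. -/
theorem IsLine.forall_mem_of_forall_mem {φ : ℝ → X} {L R : Set X} {f : X → X}
    (h : IsLine φ L R) (hf : Continuous f) {K : Set X} (hK : IsClosed K) (hφ : ∀ t, f (φ t) ∈ K) :
    ∀ x, f x ∈ K := by
  have : closure (range φ) ⊆ f ⁻¹' K := closure_minimal (range_subset_iff.2 hφ) (hK.preimage hf)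
  rw [h.dense.closure_range] at this
  exact fun x => this (mem_univ x)

end MinimalSets

namespace IsLine
variable {X : Type*} [TopologicalSpace X] [TopologicalSpace.MetrizableSpace X]
  {φ : ℝ → X} {L R : Set X} {f : X → X} {M : Set X}

theorem isArcExhausted_range (h : IsLine φ L R) : IsArcExhausted (range φ) := by
  intro M hM hMφ
  obtain ⟨b, hb⟩ := h.eventually_notMem hM (h.disjoint_right.symm.mono_left hMφ)
  obtain ⟨a, ha⟩ := h.symm.eventually_notMem hM (h.disjoint_left.symm.mono_left hMφ)
  refine ⟨φ '' Icc (-a) (max b (-a + 1)), h.isArc_image_Icc (lt_max_of_lt_right (by linarith)),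
    fun x hx => ?_, image_subset_range _ _⟩
  obtain ⟨t, rfl⟩ := hMφ hx
  refine ⟨t, ⟨?_, ?_⟩, rfl⟩
  · by_contra hlt
    exact ha (-t) (by linarith) (by simpa using hx)
  · by_contra hlt
    exact hb t ((le_max_left _ _).trans (not_le.1 hlt).le) hx

theorem isArcExhausted_range_union {r : X} (h : IsLine φ L {r}) (hr : r ∉ L) :
    IsArcExhausted (range φ ∪ {r}) := by
  intro M hM hMφ
  have hd : Disjoint M L := by
    rw [Set.disjoint_left]
    intro x hx hxL
    rcases hMφ hx with ⟨t, rfl⟩ | rfl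
    · exact h.notMem_left t hxL
    · exact hr hxL
  obtain ⟨a, ha⟩ := h.symm.eventually_notMem hM hd
  refine ⟨{r} ∪ φ '' Ici (-a), h.isArc_Ici_union _, fun x hx => ?_, ?_⟩
  · rcases hMφ hx with ⟨t, rfl⟩ | hxr
    · refine Or.inr ⟨t, mem_Ici.2 ?_, rfl⟩
      by_contra hlt
      exact ha (-t) (by linarith) (by simpa using hx)
    · exact Or.inl hxr
  · rintro x (hx | ⟨t, -, rfl⟩)
    exacts [Or.inr hx, Or.inl (mem_range_self t)]

/-- If both ends are nondegenerate, the image of a locally connected continuum is either in the line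
or disjoint from it. -/
theorem image_subset_range_or_disjoint (h : IsLine φ L R) (hL : L.Nontrivial)
    (hR : R.Nontrivial) (hf : Continuous f) {K : Set X} (hK : IsLocallyConnectedContinuum K) :
    f '' K ⊆ range φ ∨ Disjoint (f '' K) (range φ) := by
  obtain ⟨a, ha⟩ := h.exists_notMem_image_left hL hK hf
  obtain ⟨b, hb⟩ := h.exists_notMem_image hR hK hf
  exact h.subset_range_or_disjoint (hK.2.1.isPreconnected.image f hf.continuousOn) ha hb

/-- Any two points of the line lie on an arc, to which `image_subset_range_or_disjoint` applies. -/
theorem mapsTo_range_or_disjoint (h : IsLine φ L R) (hL : L.Nontrivial)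
    (hR : R.Nontrivial) (hf : Continuous f) :
    (∀ t, f (φ t) ∈ range φ) ∨ ∀ t, f (φ t) ∉ range φ := by
  by_contra! hcon
  obtain ⟨⟨s, hs⟩, t, ht⟩ := hcon
  have hne : s ≠ t := by rintro rfl; exact hs ht
  have hlt : min s t < max s t := min_lt_max.2 hne
  have hsm : f (φ s) ∈ f '' (φ '' Icc (min s t) (max s t)) :=
    ⟨_, ⟨s, ⟨min_le_left _ _, le_max_left _ _⟩, rfl⟩, rfl⟩
  have htm : f (φ t) ∈ f '' (φ '' Icc (min s t) (max s t)) :=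
    ⟨_, ⟨t, ⟨min_le_right _ _, le_max_right _ _⟩, rfl⟩, rfl⟩
  rcases h.image_subset_range_or_disjoint hL hR hf
    (h.isArc_image_Icc hlt).isLocallyConnectedContinuum with hsub | hd
  · exact hs (hsub hsm)
  · exact hd.ne_of_mem htm ht rfl

/-! ### Intersecting nondegenerate ends -/

theorem minimalSets_eq_of_inter_nonempty (h : IsLine φ L R) (hL : L.Nontrivial)
    (hR : R.Nontrivial) (hne : (L ∩ R).Nonempty) :
    minimalSets X = minimalSetsIn (L ∪ R) ∪ minimalSetsIn (range φ) := by
  have hK : IsClosed (L ∪ R) := h.left_continuum.1.isClosed.union h.right_continuum.1.isClosed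
  refine Subset.antisymm ?_ (union_subset ?_ h.isArcExhausted_range.minimalSetsIn_subset_minimalSets)
  · rintro M ⟨f, hf, hM⟩
    have hJ : ∀ x, x ∉ L ∪ R → x ∈ range φ := fun x hx => by
      rcases h.mem_cases x with h1 | h1 | h1
      exacts [(hx (Or.inl h1)).elim, h1, (hx (Or.inr h1)).elim]
    have hLR : MapsTo f (L ∪ R) (L ∪ R) ∨ MapsTo f (L ∪ R) (range φ) := by
      obtain ⟨y, hyL, hyR⟩ := hne
      rcases h.image_subset_range_or_disjoint hL hR hf h.left_continuum with h1 | h1 <;>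
        rcases h.image_subset_range_or_disjoint hL hR hf h.right_continuum with h2 | h2
      · exact Or.inr (mapsTo_iff_image_subset.2 (by rw [image_union]; exact union_subset h1 h2))
      · exact (h2.ne_of_mem (mem_image_of_mem f hyR) (h1 (mem_image_of_mem f hyL)) rfl).elim
      · exact (h1.ne_of_mem (mem_image_of_mem f hyL) (h2 (mem_image_of_mem f hyR)) rfl).elim
      · refine Or.inl fun x hx => ?_
        by_contra hfx
        rcases hx with hx | hx
        · exact h1.ne_of_mem (mem_image_of_mem f hx) (hJ _ hfx) rfl
        · exact h2.ne_of_mem (mem_image_of_mem f hx) (hJ _ hfx) rfl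
    have hfin : M ⊆ range φ → M ∈ minimalSetsIn (L ∪ R) ∪ minimalSetsIn (range φ) := fun hMJ =>
      Or.inr (h.isArcExhausted_range.mem_minimalSetsIn_of_isMinimalSetOf hM hf hMJ)
    rcases hLR with hLR | hLR
    · rcases hM.subset_or_disjoint hK hLR with h1 | h1
      · exact Or.inl (hM.mem_minimalSetsIn hf h1 hLR)
      · exact hfin fun x hx => hJ x (h1.notMem_of_mem_left hx)
    · refine hfin fun x hx => ?_
      obtain ⟨y, -, rfl⟩ := hM.exists_preimage hx
      rcases h.mapsTo_range_or_disjoint hL hR hf with h1 | h1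
      · rcases h.mem_cases y with hy | ⟨t, rfl⟩ | hy
        exacts [hLR (Or.inl hy), h1 t, hLR (Or.inr hy)]
      · obtain ⟨z, hz⟩ := hL.nonempty
        have h2 := h.forall_mem_of_forall_mem hf hK (fun t => by
          by_contra hn; exact h1 t (hJ _ hn)) z
        obtain ⟨t, ht⟩ := hLR (Or.inl hz)
        rw [← ht] at h2
        exact (h2.elim (h.notMem_left t) (h.notMem_right t)).elim
  · obtain ⟨F, hF, hFK, hid⟩ := h.exists_retraction_union hne
    exact minimalSetsIn_subset_minimalSets_of_retract hF hFK hid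

/-! ### Disjoint nondegenerate ends -/

theorem mapsTo_cases (h : IsLine φ L R) (hL : L.Nontrivial) (hR : R.Nontrivial)
    (hd : Disjoint L R) (hf : Continuous f) {K : Set X} (hK : IsLocallyConnectedContinuum K) :
    MapsTo f K L ∨ MapsTo f K R ∨ MapsTo f K (range φ) := by
  simp only [mapsTo_iff_image_subset]
  rcases h.image_subset_range_or_disjoint hL hR hf hK with h1 | h1
  · exact Or.inr (Or.inr h1)
  · have hsub : f '' K ⊆ L ∪ R := fun x hx => by
      rcases h.mem_cases x with h2 | h2 | h2
      exacts [Or.inl h2, (h1.ne_of_mem hx h2 rfl).elim, Or.inr h2]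
    have hpre := hK.2.1.isPreconnected.image f hf.continuousOn
    rcases isPreconnected_iff_subset_of_disjoint_closed.1 hpre L R
      h.left_continuum.1.isClosed h.right_continuum.1.isClosed hsub
      (by rw [hd.inter_eq, inter_empty]) with h2 | h2
    exacts [Or.inl h2, Or.inr (Or.inl h2)]

theorem minimalSets_subset_of_disjoint (h : IsLine φ L R) (hL : L.Nontrivial)
    (hR : R.Nontrivial) (hd : Disjoint L R) :
    minimalSets X ⊆ minimalSetsIn (range φ) ∪ minimalSetsIn L ∪ minimalSetsIn R ∪
      minimalSetsStar L R := by
  rintro M ⟨f, hf, hM⟩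
  have hLc := h.left_continuum.1.isClosed
  have hRc := h.right_continuum.1.isClosed
  have hJ : ∀ x, x ∉ L → x ∉ R → x ∈ range φ := fun x hx hx' => by
    rcases h.mem_cases x with h1 | h1 | h1
    exacts [(hx h1).elim, h1, (hx' h1).elim]
  have toL : MapsTo f L L → M ⊆ L → M ∈ minimalSetsIn (range φ) ∪ minimalSetsIn L ∪
      minimalSetsIn R ∪ minimalSetsStar L R := fun h1 h2 =>
    Or.inl (Or.inl (Or.inr (hM.mem_minimalSetsIn hf h2 h1)))
  have toR : MapsTo f R R → M ⊆ R → M ∈ minimalSetsIn (range φ) ∪ minimalSetsIn L ∪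
      minimalSetsIn R ∪ minimalSetsStar L R := fun h1 h2 =>
    Or.inl (Or.inr (hM.mem_minimalSetsIn hf h2 h1))
  have toJ : M ⊆ range φ → M ∈ minimalSetsIn (range φ) ∪ minimalSetsIn L ∪
      minimalSetsIn R ∪ minimalSetsStar L R := fun h1 =>
    Or.inl (Or.inl (Or.inl (h.isArcExhausted_range.mem_minimalSetsIn_of_isMinimalSetOf hM hf h1)))
  rcases h.mapsTo_range_or_disjoint hL hR hf with hφ | hφ
  · have hback : ∀ x ∈ M, (∃ y ∈ M, y ∈ L ∧ f y = x) ∨ (∃ y ∈ M, y ∈ R ∧ f y = x) ∨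
        x ∈ range φ := fun x hx => by
      obtain ⟨y, hy, rfl⟩ := hM.exists_preimage hx
      rcases h.mem_cases y with h1 | ⟨t, rfl⟩ | h1
      exacts [Or.inl ⟨y, hy, h1, rfl⟩, Or.inr (Or.inr (hφ t)), Or.inr (Or.inl ⟨y, hy, h1, rfl⟩)]
    rcases h.mapsTo_cases hL hR hd hf h.left_continuum with hfL | hfL | hfL
    · rcases hM.subset_or_disjoint hLc hfL with h1 | h1
      · exact toL hfL h1
      have h1' : ∀ x ∈ M, x ∉ L := fun x hx => h1.notMem_of_mem_left hx
      rcases h.mapsTo_cases hL hR hd hf h.right_continuum with hfR | hfR | hfR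
      · refine toJ fun x hx => ?_
        rcases hback x hx with ⟨y, hyM, hy, rfl⟩ | ⟨y, hyM, hy, rfl⟩ | h2
        exacts [(h1' y hyM hy).elim, (h1' _ hx (hfR hy)).elim, h2]
      · rcases hM.subset_or_disjoint hRc hfR with h2 | h2
        · exact toR hfR h2
        · exact toJ fun x hx => hJ x (h1' x hx) (h2.notMem_of_mem_left hx)
      · refine toJ fun x hx => ?_
        rcases hback x hx with ⟨y, hyM, hy, rfl⟩ | ⟨y, hyM, hy, rfl⟩ | h2
        exacts [(h1' y hyM hy).elim, hfR hy, h2]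
    · rcases h.mapsTo_cases hL hR hd hf h.right_continuum with hfR | hfR | hfR
      · -- the ends are interchanged
        have hK : MapsTo f (L ∪ R) (L ∪ R) := by
          rintro x (hx | hx)
          exacts [Or.inr (hfL hx), Or.inl (hfR hx)]
        rcases hM.subset_or_disjoint (hLc.union hRc) hK with h1 | h1
        · refine Or.inr ⟨hM.mem_minimalSetsIn hf h1 hK, le_antisymm ?_ ?_⟩
          · have : M ∩ L ⊆ f '' (M ∩ R) := by
              rintro x ⟨hx, hxL⟩
              obtain ⟨y, hy, rfl⟩ := hM.exists_preimage hx
              refine ⟨y, ⟨hy, (h1 hy).resolve_left fun hyL => ?_⟩, rfl⟩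
              exact hd.ne_of_mem hxL (hfL hyL) rfl
            exact (Cardinal.mk_le_mk_of_subset this).trans Cardinal.mk_image_le
          · have : M ∩ R ⊆ f '' (M ∩ L) := by
              rintro x ⟨hx, hxR⟩
              obtain ⟨y, hy, rfl⟩ := hM.exists_preimage hx
              refine ⟨y, ⟨hy, (h1 hy).resolve_right fun hyR => ?_⟩, rfl⟩
              exact hd.ne_of_mem (hfR hyR) hxR rfl
            exact (Cardinal.mk_le_mk_of_subset this).trans Cardinal.mk_image_le
        · exact toJ fun x hx => hJ x (fun hxL => h1.ne_of_mem hx (Or.inl hxL) rfl)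
            fun hxR => h1.ne_of_mem hx (Or.inr hxR) rfl
      · rcases hM.subset_or_disjoint hRc hfR with h1 | h1
        · exact toR hfR h1
        have h1' : ∀ x ∈ M, x ∉ R := fun x hx => h1.notMem_of_mem_left hx
        refine toJ fun x hx => ?_
        rcases hback x hx with ⟨y, hyM, hy, rfl⟩ | ⟨y, hyM, hy, rfl⟩ | h2
        exacts [(h1' _ hx (hfL hy)).elim, (h1' y hyM hy).elim, h2]
      · -- no point of `L` is an image, since `f` maps `L` to `R` and the rest to the line
        have hML : ∀ x ∈ M, x ∉ L := fun x hx hxL => by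
          rcases hback x hx with ⟨y, hyM, hy, rfl⟩ | ⟨y, hyM, hy, rfl⟩ | h2
          · exact hd.ne_of_mem hxL (hfL hy) rfl
          · obtain ⟨t, ht⟩ := hfR hy; exact h.notMem_left t (ht ▸ hxL)
          · obtain ⟨t, ht⟩ := h2; exact h.notMem_left t (ht ▸ hxL)
        refine toJ fun x hx => ?_
        rcases hback x hx with ⟨y, hyM, hy, rfl⟩ | ⟨y, hyM, hy, rfl⟩ | h2
        exacts [(hML y hyM hy).elim, hfR hy, h2]
    · rcases h.mapsTo_cases hL hR hd hf h.right_continuum with hfR | hfR | hfR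
      · -- no point of `R` is an image
        have hMR : ∀ x ∈ M, x ∉ R := fun x hx hxR => by
          rcases hback x hx with ⟨y, hyM, hy, rfl⟩ | ⟨y, hyM, hy, rfl⟩ | h2
          · obtain ⟨t, ht⟩ := hfL hy; exact h.notMem_right t (ht ▸ hxR)
          · exact hd.ne_of_mem (hfR hy) hxR rfl
          · obtain ⟨t, ht⟩ := h2; exact h.notMem_right t (ht ▸ hxR)
        refine toJ fun x hx => ?_
        rcases hback x hx with ⟨y, hyM, hy, rfl⟩ | ⟨y, hyM, hy, rfl⟩ | h2
        exacts [hfL hy, (hMR y hyM hy).elim, h2]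
      · rcases hM.subset_or_disjoint hRc hfR with h1 | h1
        · exact toR hfR h1
        refine toJ fun x hx => ?_
        rcases hback x hx with ⟨y, hyM, hy, rfl⟩ | ⟨y, hyM, hy, rfl⟩ | h2
        exacts [hfL hy, (h1.ne_of_mem hyM hy rfl).elim, h2]
      · refine toJ fun x hx => ?_
        rcases hback x hx with ⟨y, hyM, hy, rfl⟩ | ⟨y, hyM, hy, rfl⟩ | h2
        exacts [hfL hy, hfR hy, h2]
  · have hsub : f '' range φ ⊆ L ∪ R := by
      rintro _ ⟨_, ⟨t, rfl⟩, rfl⟩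
      by_contra hn
      exact hφ t (hJ _ (fun h1 => hn (Or.inl h1)) fun h1 => hn (Or.inr h1))
    have hpre : IsPreconnected (f '' range φ) :=
      (isPreconnected_range h.isOpenEmbedding.continuous).image f hf.continuousOn
    rcases isPreconnected_iff_subset_of_disjoint_closed.1 hpre L R hLc hRc hsub
      (by rw [hd.inter_eq, inter_empty]) with h2 | h2
    · have h3 := h.forall_mem_of_forall_mem hf hLc fun t => h2 ⟨_, mem_range_self t, rfl⟩
      refine toL (fun x _ => h3 x) fun x hx => ?_
      obtain ⟨y, -, rfl⟩ := hM.exists_preimage hx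
      exact h3 y
    · have h3 := h.forall_mem_of_forall_mem hf hRc fun t => h2 ⟨_, mem_range_self t, rfl⟩
      refine toR (fun x _ => h3 x) fun x hx => ?_
      obtain ⟨y, -, rfl⟩ := hM.exists_preimage hx
      exact h3 y

theorem minimalSetsIn_left_subset (h : IsLine φ L R) (hd : Disjoint L R) :
    minimalSetsIn L ⊆ minimalSets X := by
  obtain ⟨F, hF, hFL, hid⟩ := h.exists_retraction_left hd
  exact minimalSetsIn_subset_minimalSets_of_retract hF hFL hid

theorem minimalSetsIn_right_subset (h : IsLine φ L R) (hd : Disjoint L R) :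
    minimalSetsIn R ⊆ minimalSets X :=
  h.symm.minimalSetsIn_left_subset hd.symm

theorem disjoint_minimalSetsStar (h : IsLine φ L R) (hd : Disjoint L R) :
    Disjoint (minimalSetsIn (range φ) ∪ minimalSetsIn L ∪ minimalSetsIn R)
      (minimalSetsStar L R) := by
  rw [Set.disjoint_left]
  rintro M hM ⟨hMLR, hcard⟩
  obtain ⟨hsub, f, -, -, hmin⟩ := mem_minimalSetsIn_iff.1 hMLR
  have hne : (M ∩ L).Nonempty ∧ (M ∩ R).Nonempty := by
    have hiff : (M ∩ L).Nonempty ↔ (M ∩ R).Nonempty := by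
      rw [← nonempty_coe_sort, ← Cardinal.mk_ne_zero_iff, hcard, Cardinal.mk_ne_zero_iff,
        nonempty_coe_sort]
    obtain ⟨x, hx⟩ := hmin.1
    rcases hsub hx with h1 | h1
    · exact ⟨⟨x, hx, h1⟩, hiff.1 ⟨x, hx, h1⟩⟩
    · exact ⟨hiff.2 ⟨x, hx, h1⟩, ⟨x, hx, h1⟩⟩
  obtain ⟨⟨x, hxM, hxL⟩, y, hyM, hyR⟩ := hne
  rcases hM with (hM | hM) | hM
  · obtain ⟨t, rfl⟩ := (mem_minimalSetsIn_iff.1 hM).1 hxM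
    exact h.notMem_left t hxL
  · exact hd.ne_of_mem ((mem_minimalSetsIn_iff.1 hM).1 hyM) hyR rfl
  · exact hd.ne_of_mem hxL ((mem_minimalSetsIn_iff.1 hM).1 hxM) rfl

/-! ### One end is a point -/

theorem minimalSets_eq_of_notMem {r : X} (h : IsLine φ L {r}) (hL : L.Nontrivial) (hr : r ∉ L) :
    minimalSets X = minimalSetsIn L ∪ minimalSetsIn (range φ ∪ {r}) := by
  have hd : Disjoint L {r} := disjoint_singleton_right.2 hr
  have hLc := h.left_continuum.1.isClosed
  have hex := h.isArcExhausted_range_union hr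
  refine Subset.antisymm ?_ (union_subset (h.minimalSetsIn_left_subset hd)
    hex.minimalSetsIn_subset_minimalSets)
  rintro M ⟨f, hf, hM⟩
  have hJ : ∀ x ∉ L, x ∈ range φ ∪ {r} := fun x hx => by
    rcases h.mem_cases x with h1 | h1 | h1
    exacts [(hx h1).elim, Or.inl h1, Or.inr h1]
  have hcases : ∀ K, IsLocallyConnectedContinuum K →
      f '' K ⊆ L ∨ f '' K ⊆ range φ ∪ {r} := fun K hK => by
    obtain ⟨a, ha⟩ := h.exists_notMem_image_left hL hK hf
    exact h.subset_left_or_right hd (hK.2.1.isPreconnected.image f hf.continuousOn) ha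
  have toL : MapsTo f L L → M ⊆ L → M ∈ minimalSetsIn L ∪ minimalSetsIn (range φ ∪ {r}) :=
    fun h1 h2 => Or.inl (hM.mem_minimalSetsIn hf h2 h1)
  have toJ : M ⊆ range φ ∪ {r} → M ∈ minimalSetsIn L ∪ minimalSetsIn (range φ ∪ {r}) :=
    fun h1 => Or.inr (hex.mem_minimalSetsIn_of_isMinimalSetOf hM hf h1)
  have harc : ∀ t, f '' ({r} ∪ φ '' Ici t) ⊆ L ∨ f '' ({r} ∪ φ '' Ici t) ⊆ range φ ∪ {r} :=
    fun t => hcases _ (h.isArc_Ici_union t).isLocallyConnectedContinuum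
  have hdisj : ∀ x ∈ range φ ∪ {r}, x ∉ L := by
    rintro _ (⟨t, rfl⟩ | rfl)
    exacts [h.notMem_left t, hr]
  have hmem : ∀ t, f (φ t) ∈ f '' ({r} ∪ φ '' Ici t) := fun t =>
    ⟨_, Or.inr ⟨t, self_mem_Ici, rfl⟩, rfl⟩
  have hmemr : ∀ t, f r ∈ f '' ({r} ∪ φ '' Ici t) := fun t => ⟨_, Or.inl rfl, rfl⟩
  by_cases hfr : f r ∈ L
  · have h3 := h.forall_mem_of_forall_mem hf hLc fun t => by
      rcases harc t with h1 | h1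
      · exact h1 (hmem t)
      · exact (hdisj _ (h1 (hmemr t)) hfr).elim
    refine toL (fun x _ => h3 x) fun x hx => ?_
    obtain ⟨y, -, rfl⟩ := hM.exists_preimage hx
    exact h3 y
  · have hφ : ∀ t, f (φ t) ∈ range φ ∪ {r} := fun t => by
      rcases harc t with h1 | h1
      · exact (hfr (h1 (hmemr t))).elim
      · exact h1 (hmem t)
    rcases hcases L h.left_continuum with h1 | h1
    · rcases hM.subset_or_disjoint hLc (mapsTo_iff_image_subset.2 h1) with h2 | h2
      · exact toL (mapsTo_iff_image_subset.2 h1) h2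
      · exact toJ fun x hx => hJ x (h2.notMem_of_mem_left hx)
    · refine toJ fun x hx => ?_
      obtain ⟨y, -, rfl⟩ := hM.exists_preimage hx
      rcases h.mem_cases y with hy | ⟨t, rfl⟩ | hy
      · exact h1 (mem_image_of_mem f hy)
      · exact hφ t
      · rw [mem_singleton_iff.1 hy]; exact hJ _ hfr

/-- The arcs in `J ∪ {r}` that contain the degenerate end `r` are the closed half-lines with `r`
added. They cannot reach the other end by the escape lemma `exists_notMem_image_left`. -/
theorem eq_of_isArc {r : X} (h : IsLine φ L {r}) (hL : L.Nontrivial) {A : Set X} (hA : IsArc A)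
    (hrA : r ∈ A) (hsub : A ⊆ {r} ∪ range φ) : ∃ c, A = {r} ∪ φ '' Ici c := by
  obtain ⟨a, ha⟩ := h.exists_notMem_image_left hL hA.isLocallyConnectedContinuum continuous_id
  rw [image_id] at ha
  have hup : ∀ s t, s ≤ t → φ s ∈ A → φ t ∈ A := by
    intro s t hst hs
    by_contra ht
    have h1 : a < s := not_le.1 fun h1 => ha s h1 hs
    have h2 : s < t := lt_of_le_of_ne hst (by rintro rfl; exact ht hs)
    obtain ⟨q, -, hq⟩ := h.subset_image_Ioo hA.isPathConnected.isConnected.isPreconnected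
      ⟨h1, h2⟩ hs (ha a le_rfl) ht hrA
    exact h.notMem_right q hq
  have hne : (φ ⁻¹' A).Nonempty := by
    obtain ⟨x, hx, hxr⟩ := hA.nontrivial.exists_ne r
    rcases hsub hx with h1 | ⟨t, rfl⟩
    exacts [(hxr h1).elim, ⟨t, hx⟩]
  have hbdd : BddBelow (φ ⁻¹' A) := ⟨a, fun t ht => (not_le.1 fun h1 => ha t h1 ht).le⟩
  have hc : φ (sInf (φ ⁻¹' A)) ∈ A :=
    (hA.isCompact.isClosed.preimage h.isOpenEmbedding.continuous).csInf_mem hne hbdd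
  refine ⟨sInf (φ ⁻¹' A), Subset.antisymm (fun x hx => ?_) ?_⟩
  · rcases hsub hx with h1 | ⟨t, rfl⟩
    · exact Or.inl h1
    · exact Or.inr ⟨t, csInf_le hbdd hx, rfl⟩
  · rintro x (rfl | ⟨t, ht, rfl⟩)
    exacts [hrA, hup _ t ht hc]

/-- If the degenerate end is in `L` and `f` maps some point `x₀` of `L` into the line, then the whole
image of `f` stays away from the left end within the line. The part of the line near `L` comes back
near `x₀` again and again, so its images under `f` come back near `f x₀`; as they avoid a point `φ a`
on the left of `f x₀`, they cannot be on the left of `φ a`. -/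
theorem exists_forall_mem_union_arc {r : X} (h : IsLine φ L {r}) (hL : L.Nontrivial) (hr : r ∈ L)
    (hf : Continuous f) (hfL : ¬ MapsTo f L L) :
    ∃ c, ∀ x, f x ∈ L ∪ ({r} ∪ φ '' Ici c) := by
  obtain ⟨x₀, hx₀, p, hp⟩ : ∃ x₀ ∈ L, ∃ p, φ p = f x₀ := by
    rw [MapsTo] at hfL
    push Not at hfL
    obtain ⟨x, hx, hfx⟩ := hfL
    rcases h.mem_cases (f x) with h1 | ⟨p, hp⟩ | h1
    · exact (hfx h1).elim
    · exact ⟨x, hx, p, hp⟩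
    · exact (hfx (by rw [mem_singleton_iff.1 h1]; exact hr)).elim
  obtain ⟨a, ha⟩ := h.exists_notMem_image_left hL h.left_continuum hf
  have hpa : a < p := not_le.1 fun h1 => ha p h1 ⟨x₀, hx₀, hp.symm⟩
  -- near the left end, the image of the line misses `φ a`
  obtain ⟨b, hb⟩ := eventually_atTop.1 (h.left_end.eventually_mem (f ⁻¹' {φ a}ᶜ)
    (isOpen_compl_singleton.preimage hf) fun x hx hfx => ha a le_rfl ⟨x, hx, hfx⟩)
  have hb : ∀ t ≤ -b, f (φ t) ≠ φ a := fun t ht => by simpa using hb (-t) (by linarith)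
  have key : ∀ t ≤ -b, ∀ s ≤ a, f (φ t) ≠ φ s := by
    intro t ht s hs hts
    have hsa : s < a := lt_of_le_of_ne hs (by rintro rfl; exact hb t ht hts)
    obtain ⟨q, hq, hqp⟩ := frequently_atTop.1 (h.left_end.frequently_mem x₀ hx₀
      (f ⁻¹' (φ '' Ioi a)) ((h.isOpenEmbedding.isOpenMap _ isOpen_Ioi).preimage hf)
      ⟨p, hpa, hp⟩) (-t + 1)
    have hqt : -q < t := by linarith
    have hmem : ∀ v ∈ Icc (-q) t, f (φ v) ∈ f '' (φ '' Icc (-q) t) := fun v hv =>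
      ⟨_, ⟨v, hv, rfl⟩, rfl⟩
    have harc := (h.isArc_image_Icc hqt).isLocallyConnectedContinuum
    obtain ⟨a', ha'⟩ := h.exists_notMem_image_left hL harc hf
    have hst : φ s ∈ f '' (φ '' Icc (-q) t) := by
      rw [← hts]; exact hmem t ⟨hqt.le, le_rfl⟩
    have ha's : a' < s := not_le.1 fun h1 => ha' s h1 hst
    have hsub := h.subset_image_Ioo (harc.2.1.isPreconnected.image f hf.continuousOn)
      ⟨ha's, hsa⟩ hst (ha' a' le_rfl) (by
        rintro ⟨_, ⟨v, hv, rfl⟩, hva⟩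
        exact hb v (hv.2.trans ht) hva)
    obtain ⟨v, hv, hvq⟩ := hsub (hmem (-q) ⟨le_rfl, hqt.le⟩)
    obtain ⟨w, hw, hwq⟩ := hqp
    have : v = w := h.isOpenEmbedding.injective (hvq.trans hwq.symm)
    have := mem_Ioi.1 hw
    linarith [hv.2]
  obtain ⟨a', ha'⟩ := h.exists_notMem_image_left hL
    (h.isArc_Ici_union (-b)).isLocallyConnectedContinuum hf
  refine ⟨min a a', fun x => ?_⟩
  rcases h.mem_cases (f x) with h1 | ⟨s, hs⟩ | h1
  · exact Or.inl h1
  · refine Or.inr (Or.inr ⟨s, mem_Ici.2 (not_lt.1 fun hlt => ?_), hs⟩)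
    have hsa : s ≤ a := hlt.le.trans (min_le_left _ _)
    have hsa' : s ≤ a' := hlt.le.trans (min_le_right _ _)
    rcases h.mem_cases x with hx | ⟨t, rfl⟩ | hx
    · exact ha s hsa ⟨x, hx, hs.symm⟩
    · rcases le_total t (-b) with ht | ht
      · exact key t ht s hsa hs.symm
      · exact ha' s hsa' ⟨_, Or.inr ⟨t, ht, rfl⟩, hs.symm⟩
    · exact ha' s hsa' ⟨x, Or.inl hx, hs.symm⟩
  · exact Or.inr (Or.inl h1)

theorem minimalSets_eq_of_mem {r : X} (h : IsLine φ L {r}) (hL : L.Nontrivial) (hr : r ∈ L) :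
    minimalSets X = ⋃₀ {S | ∃ A : Set X, IsArc A ∧ {r} ⊆ A ∧ A ⊂ {r} ∪ range φ ∧
      S = minimalSetsIn (L ∪ A)} := by
  classical
  have hLc := h.left_continuum.1.isClosed
  refine Subset.antisymm ?_ ?_
  · rintro M ⟨f, hf, hM⟩
    suffices ∃ c, M ∈ minimalSetsIn (L ∪ ({r} ∪ φ '' Ici c)) by
      obtain ⟨c, hc⟩ := this
      exact ⟨_, ⟨_, h.isArc_Ici_union c, subset_union_left, h.Ici_union_ssubset c, rfl⟩, hc⟩
    by_cases hfL : MapsTo f L L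
    · rcases hM.subset_or_disjoint hLc hfL with h1 | h1
      · -- collapse the arc to the point `r`
        refine ⟨0, ?_⟩
        have harc := (h.isArc_Ici_union 0).isCompact.isClosed
        have hF : ContinuousOn (fun x => if x ∈ L then x else r) (L ∪ ({r} ∪ φ '' Ici 0)) := by
          refine ContinuousOn.union_of_isClosed ?_ ?_ hLc harc
          · exact continuousOn_id.congr fun x hx => if_pos hx
          · refine (continuousOn_const (c := r)).congr ?_
            rintro x (hx | ⟨t, -, rfl⟩)
            · rw [mem_singleton_iff.1 hx]; exact if_pos hr
            · exact if_neg (h.notMem_left t)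
        refine minimalSetsIn_subset_of_retract subset_union_left hF (fun x _ => ?_)
          (fun x hx => if_pos hx) (hM.mem_minimalSetsIn hf h1 hfL)
        dsimp only
        split_ifs with hx
        exacts [hx, hr]
      · have hMφ : M ⊆ range φ := fun x hx => by
          rcases h.mem_cases x with h2 | h2 | h2
          · exact (h1.ne_of_mem hx h2 rfl).elim
          · exact h2
          · exact (h1.ne_of_mem hx (by rwa [mem_singleton_iff.1 h2]) rfl).elim
        have hfc := h.isArcExhausted_range.mem_finiteOrCantorSubsets hM hf.continuousOn hMφ
        obtain ⟨a, ha⟩ := h.symm.eventually_notMem hM.2.1 h1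
        refine ⟨-a, mem_minimalSetsIn_of_subset_arc hfc.2 (h.isArc_Ici_union (-a)) (fun x hx => ?_)
          subset_union_right⟩
        obtain ⟨t, rfl⟩ := hMφ hx
        refine Or.inr ⟨t, mem_Ici.2 ?_, rfl⟩
        by_contra hlt
        exact ha (-t) (by linarith) (by simpa using hx)
    · obtain ⟨c, hc⟩ := h.exists_forall_mem_union_arc hL hr hf hfL
      refine ⟨c, hM.mem_minimalSetsIn hf (fun x hx => ?_) fun x _ => hc x⟩
      obtain ⟨y, -, rfl⟩ := hM.exists_preimage hx
      exact hc y
  · rintro M ⟨_, ⟨A, hA, hrA, hAs, rfl⟩, hM⟩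
    obtain ⟨c, rfl⟩ := h.eq_of_isArc hL hA (hrA rfl) hAs.subset
    obtain ⟨F, hF, hFA, hid⟩ := h.exists_retraction_union_arc hr c
    exact minimalSetsIn_subset_minimalSets_of_retract hF hFA hid hM

end IsLine
end DenseFreeInterval

open DenseFreeInterval

theorem theoremA {X : Type*} [TopologicalSpace X] [TopologicalSpace.MetrizableSpace X]
    [CompactSpace X] [ConnectedSpace X] (L J R : Set X) (hX : IsDecomposition L J R) :
    ((∃ r, R = {r}) → L.Nontrivial → R ⊆ L →
      minimalSets X = ⋃₀ {S | ∃ A : Set X, IsArc A ∧ R ⊆ A ∧ A ⊂ R ∪ J ∧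
        S = minimalSetsIn (L ∪ A)}) ∧
    ((∃ r, R = {r}) → L.Nontrivial → L ∩ R = ∅ →
      minimalSets X = minimalSetsIn L ∪ minimalSetsIn (J ∪ R) ∧
      Disjoint (minimalSetsIn L) (minimalSetsIn (J ∪ R)) ∧
      minimalSetsIn (J ∪ R) = finiteOrCantorSubsets (J ∪ R)) ∧
    (L.Nontrivial → R.Nontrivial → (L ∩ R).Nonempty →
      minimalSets X = minimalSetsIn (L ∪ R) ∪ minimalSetsIn J ∧
      Disjoint (minimalSetsIn (L ∪ R)) (minimalSetsIn J) ∧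
      minimalSetsIn J = finiteOrCantorSubsets J) ∧
    (L.Nontrivial → R.Nontrivial → L ∩ R = ∅ →
      minimalSets X ⊆
        minimalSetsIn J ∪ minimalSetsIn L ∪ minimalSetsIn R ∪ minimalSetsStar L R ∧
      minimalSetsIn J ∪ minimalSetsIn L ∪ minimalSetsIn R ⊆ minimalSets X ∧
      Disjoint (minimalSetsIn J) (minimalSetsIn L) ∧
      Disjoint (minimalSetsIn J ∪ minimalSetsIn L) (minimalSetsIn R) ∧
      Disjoint (minimalSetsIn J ∪ minimalSetsIn L ∪ minimalSetsIn R) (minimalSetsStar L R) ∧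
      minimalSetsIn J = finiteOrCantorSubsets J) := by
  obtain ⟨φ, h, rfl⟩ := hX.exists_isLine
  refine ⟨?_, ?_, fun hL hR hne => ?_, fun hL hR hLR => ?_⟩
  · rintro ⟨r, rfl⟩ hL hr
    exact h.minimalSets_eq_of_mem hL (hr rfl)
  · rintro ⟨r, rfl⟩ hL hLr
    have hd := Set.disjoint_iff_inter_eq_empty.2 hLr
    have hr : r ∉ L := Set.disjoint_singleton_right.1 hd
    exact ⟨h.minimalSets_eq_of_notMem hL hr,
      disjoint_minimalSetsIn (disjoint_union_right.2 ⟨h.disjoint_left, hd⟩),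
      (h.isArcExhausted_range_union hr).minimalSetsIn_eq⟩
  · exact ⟨h.minimalSets_eq_of_inter_nonempty hL hR hne,
      disjoint_minimalSetsIn (disjoint_union_left.2 ⟨h.disjoint_left, h.disjoint_right⟩),
      h.isArcExhausted_range.minimalSetsIn_eq⟩
  · have hd := Set.disjoint_iff_inter_eq_empty.2 hLR
    exact ⟨h.minimalSets_subset_of_disjoint hL hR hd,
      union_subset (union_subset h.isArcExhausted_range.minimalSetsIn_subset_minimalSets
        (h.minimalSetsIn_left_subset hd)) (h.minimalSetsIn_right_subset hd),
      disjoint_minimalSetsIn h.disjoint_left.symm,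
      disjoint_union_left.2 ⟨disjoint_minimalSetsIn h.disjoint_right.symm,
        disjoint_minimalSetsIn hd⟩,
      h.disjoint_minimalSetsStar hd, h.isArcExhausted_range.minimalSetsIn_eq⟩
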